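/- Let $L^2=L^2(\mathbb R^3)$ be the space of complex-valued square-integrable functions with norm $\|\cdot\|$, let $H^2=H^2(\mathbb R^3)$ be the Sobolev space with norm $\|f\|_{H^2}=\sqrt{\|(-\Delta)f\|^2+\|f\|^2}$, and let $\Delta_{S^2}$ be the Laplace–Beltrami operator of the unit sphere $S^2\subset\mathbb R^3$. For a twice differentiable function $\varphi$ on $\mathbb R^3$ let $$\Bigl(\tfrac{\Delta_{S^2}}{|x|^2}\varphi\Bigr)(r\omega)=\frac1{r^2}\,\bigl(\Delta_{S^2}\,\varphi(r\,\cdot)\bigr)(\omega)\qquad(r>0,\ \omega\in S^2).$$ For $f\in L^2$, we say that $\tfrac{\Delta_{S^2}}{|x|^2}f=g\in L^2$ (in the sense of distributions on $\mathbb R^3\setminus\{0\}$) if $\int g\varphi\,dx=\int f\,\tfrac{\Delta_{S^2}}{|x|^2}\varphi\,dx$ for all $\varphi\in C_c^\infty(\mathbb R^3\setminus\{0\})$. Then for every $f\in H^2$ there is exactly one $g\in L^2$ with $\tfrac{\Delta_{S^2}}{|x|^2}f=g$, and $$\Bigl\|\tfrac{\Delta_{S^2}}{|x|^2}f\Bigr\|\le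 22\,\|f\|_{H^2}.$$ Moreover, $\tfrac{\Delta_{S^2}}{|x|^2}$, defined pointwise on $C_c^\infty(\mathbb R^3)\subset H^2$ by the formula above, extends uniquely to a bounded linear operator $T:H^2\to L^2$; it satisfies $\|T\|_{H^2\to L^2}\le 22$, and $Tf=\tfrac{\Delta_{S^2}}{|x|^2}f$ in the sense of distributions on $\mathbb R^3\setminus\{0\}$ for every $f\in H^2$. -/

import Mathlib

open MeasureTheory TemperedDistribution
open scoped ContDiff ENNReal Laplacian SchwartzMap

noncomputable section

namespace SphericalHardy

/-- Euclidean space `ℝ³`. -/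
abbrev E3 : Type := EuclideanSpace ℝ (Fin 3)

/-- The Euclidean plane, the model space of the charts of `S²`. -/
abbrev E2 : Type := EuclideanSpace ℝ (Fin 2)

/-- The unit sphere `S² ⊆ ℝ³`. -/
abbrev S2 : Type := Metric.sphere (0 : E3) 1

/-- Complex-valued `L²(ℝ³)` with Lebesgue measure. -/
abbrev L2 : Type := Lp ℂ 2 (volume : Measure E3)

/-! ### The Sobolev space `H²(ℝ³)` -/

/-- The elements of `L²(ℝ³)` that lie in the Sobolev space `H²(ℝ³)`. -/
def sobolevH2 : Submodule ℂ L2 where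
  carrier := {f | MemSobolev 2 2 (f : 𝓢'(E3, ℂ))}
  add_mem' {f g} hf hg := by
    have h := MemSobolev.add hf hg
    simp only [← Lp.toTemperedDistributionCLM_apply, ← map_add] at h
    exact h
  zero_mem' := by
    have h := memSobolev_fun_zero E3 ℂ 2 2
    rw [← map_zero (Lp.toTemperedDistributionCLM ℂ (volume : Measure E3) 2)] at h
    exact h
  smul_mem' c f hf := by
    have h := MemSobolev.smul c hf
    simp only [← Lp.toTemperedDistributionCLM_apply, ← map_smul] at h
    exact h

theorem exists_laplacian (f : sobolevH2) :
    ∃ g : L2, Δ ((f : L2) : 𝓢'(E3, ℂ)) = (g : 𝓢'(E3, ℂ)) := by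
  have h : MemSobolev ((2 : ℝ) - 2) 2 (Δ ((f : L2) : 𝓢'(E3, ℂ))) := MemSobolev.laplacian f.2
  rw [sub_self] at h
  exact memSobolev_zero_iff.1 h

theorem toTemperedDistribution_injective :
    Function.Injective (Lp.toTemperedDistributionCLM ℂ (volume : Measure E3) 2) :=
  LinearMap.ker_eq_bot.1 Lp.ker_toTemperedDistributionCLM_eq_bot

/-- The distributional Laplacian `H² → L²`: `weakLaplacian f` is the unique element of `L²` that
represents the tempered distribution `Δ f`. -/
def weakLaplacian : sobolevH2 →ₗ[ℂ] L2 where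
  toFun f := (exists_laplacian f).choose
  map_add' f g := by
    apply toTemperedDistribution_injective
    rw [map_add]
    simp only [Lp.toTemperedDistributionCLM_apply]
    rw [← (exists_laplacian f).choose_spec, ← (exists_laplacian g).choose_spec,
      ← (exists_laplacian (f + g)).choose_spec]
    simp only [← Lp.toTemperedDistributionCLM_apply, Submodule.coe_add, map_add,
      ← TemperedDistribution.laplacianCLM_apply]
  map_smul' c f := by
    apply toTemperedDistribution_injective
    rw [RingHom.id_apply, map_smul]
    simp only [Lp.toTemperedDistributionCLM_apply]
    rw [← (exists_laplacian f).choose_spec, ← (exists_laplacian (c • f)).choose_spec]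
    simp only [← Lp.toTemperedDistributionCLM_apply, Submodule.coe_smul, map_smul,
      ← TemperedDistribution.laplacianCLM_apply]

theorem weakLaplacian_spec (f : sobolevH2) :
    Δ ((f : L2) : 𝓢'(E3, ℂ)) = ((weakLaplacian f : L2) : 𝓢'(E3, ℂ)) :=
  (exists_laplacian f).choose_spec

/-- The space `H²(ℝ³)`, a type of its own because it carries the `H²` norm and not the `L²` norm. -/
def H2 : Type := sobolevH2

namespace H2

instance : AddCommGroup H2 := inferInstanceAs (AddCommGroup sobolevH2)

instance : Module ℂ H2 := inferInstanceAs (Module ℂ sobolevH2)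

/-- The inclusion `H² ⊆ L²`. -/
def toL2 : H2 →ₗ[ℂ] L2 := sobolevH2.subtype

/-- The Laplacian `Δ : H² → L²`. -/
def lap : H2 →ₗ[ℂ] L2 := weakLaplacian

/-- The map `f ↦ (-Δ f, f)` into the Hilbert sum `L² ⊕ L²`, which induces the `H²` norm. -/
def graph : H2 →ₗ[ℂ] WithLp 2 (L2 × L2) :=
  (WithLp.linearEquiv 2 ℂ (L2 × L2)).symm.toLinearMap ∘ₗ (-lap).prod toL2

theorem graph_injective : Function.Injective graph := fun _ _ h =>
  Subtype.ext (congrArg (fun p : WithLp 2 (L2 × L2) => p.snd) h)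

instance : NormedAddCommGroup H2 :=
  NormedAddCommGroup.induced H2 (WithLp 2 (L2 × L2)) graph graph_injective

instance : NormedSpace ℂ H2 := NormedSpace.induced ℂ H2 (WithLp 2 (L2 × L2)) graph

/-- The norm of `H²` is `‖f‖_{H²} = √(‖-Δ f‖² + ‖f‖²)`. -/
theorem norm_eq (f : H2) : ‖f‖ = √(‖-lap f‖ ^ 2 + ‖toL2 f‖ ^ 2) :=
  WithLp.prod_norm_eq_of_L2 (graph f)

end H2

/-! ### The Laplace–Beltrami operator of `S²` -/

/-- The inverse of the stereographic chart of `S²` centred at `p`, a local parametrization of the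
sphere by the plane. -/
def param (p : S2) (y : E2) : S2 := (chartAt E2 p).symm y

/-- The `i`-th partial derivative of a map on the plane. -/
def partialDeriv {V : Type*} [NormedAddCommGroup V] [NormedSpace ℝ V] (i : Fin 2) (F : E2 → V)
    (y : E2) : V :=
  fderiv ℝ F y (EuclideanSpace.single i 1)

/-- The matrix `(g_{ij})` of the round metric, that is, of the metric induced from `ℝ³`, in the
stereographic chart centred at `p`. -/
def metricMatrix (p : S2) (y : E2) : Matrix (Fin 2) (Fin 2) ℝ := fun i j =>
  inner ℝ (partialDeriv i (fun z => (param p z : E3)) y)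
    (partialDeriv j (fun z => (param p z : E3)) y)

/-- The Laplace–Beltrami operator of the round sphere `S²`, by the formula
`Δ u = (det g)^{-1/2} ∑ᵢ ∂ᵢ ((det g)^{1/2} ∑ⱼ g^{ij} ∂ⱼ u)` in local coordinates. The coordinates
used at `p` are those of the stereographic chart centred at `p`. -/
def laplaceBeltrami (u : S2 → ℂ) (p : S2) : ℂ :=
  let y₀ : E2 := chartAt E2 p p
  (√(metricMatrix p y₀).det)⁻¹ • ∑ i, partialDeriv i
    (fun y => √(metricMatrix p y).det •
      ∑ j, (metricMatrix p y)⁻¹ i j • partialDeriv j (fun z => u (param p z)) y) y₀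

/-- The direction `x / |x| ∈ S²` of a nonzero vector. -/
def direction (x : E3) (hx : x ≠ 0) : S2 :=
  ⟨‖x‖⁻¹ • x, by simp [norm_smul, hx]⟩

open Classical in
/-- The function `(Δ_{S²} / |x|²) φ` for a (twice differentiable) function `φ` on `ℝ³`: at
`x = r p` with `r = |x| > 0` and `p ∈ S²`, the operator `Δ_{S²}` is applied to the function
`θ ↦ φ (r θ)` on `S²`, and the result at `p` is divided by `r²`. The value at the
origin, a null set, is irrelevant. -/
def angular (φ : E3 → ℂ) (x : E3) : ℂ :=
  if hx : x = 0 then 0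
  else (‖x‖ ^ 2)⁻¹ • laplaceBeltrami (fun θ => φ (‖x‖ • (θ : E3))) (direction x hx)

/-- `g = (Δ_{S²} / |x|²) f` in the sense of distributions on `ℝ³ \ {0}`. The operator
`Δ_{S²} / |x|²` has smooth real coefficients there and is its own formal transpose, because `Δ_{S²}`
is symmetric on every sphere. -/
def IsWeakAngular (f g : L2) : Prop :=
  ∀ φ : E3 → ℂ, ContDiff ℝ ∞ φ → HasCompactSupport φ → (0 : E3) ∉ tsupport φ →
    ∫ x, g x * φ x = ∫ x, f x * angular φ x

/-- `T` extends `Δ_{S²} / |x|²` from `C_c^∞(ℝ³)`. -/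
def ExtendsAngular (T : H2 →L[ℂ] L2) : Prop :=
  ∀ φ : E3 → ℂ, ContDiff ℝ ∞ φ → HasCompactSupport φ →
    ∃ f : H2, (f.toL2 : E3 → ℂ) =ᵐ[volume] φ ∧ (T f : E3 → ℂ) =ᵐ[volume] angular φ

end SphericalHardy

end

noncomputable section

/-! On a sphere of radius `r`, the Euclidean Laplacian splits off its radial part, so that `(Δ_{S²}
/ |x|²) φ = Δφ - ∂_r²φ - (2/r) ∂_r φ` away from the origin. For a test function each of the three
terms is controlled in `L²` by `Δφ`. The second is at most the Hessian pointwise, and integration by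
parts gives `∫ |D²φ|² = ∫ |Δφ|²` (`integral_hessian`). The third is at most `2 |∇φ| / |x|`, and
Hardy's inequality (`hardy`), applied to each `∂_i φ`, bounds its square integral by `16 ∫ |D²φ|²`.
Together the squared norm is at most `54 ‖Δφ‖²`, and `54 ≤ 22²`; the constant 22 leaves ample room.

The Cartesian formula `angular_eq` comes from the definition in charts: stereographic coordinates
are conformal, so in dimension two the Laplace–Beltrami operator at the centre of a chart is the
flat Laplacian.

Test functions are dense in `H²` (`denseRange_testToH2`): Bessel potentials reduce density of
Schwartz functions to density in `L²`, and cutoffs do the rest. Hence the operator has a unique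
bounded extension. That the extension acts in the sense of distributions passes to the limit from
test functions, where it is the symmetry of the operator: `Δ_{S²}` is a sum of squares of angular
momenta, each antisymmetric and each commuting with multiplication by `|x|²`. Weak values are unique
because a point is a null set, so the norm bound for the extension is a bound for every weak value.
-/

namespace SphericalHardy

/-! ### Stereographic coordinates and the round metric -/

/-- The conformal factor of the stereographic chart. -/
def conf (y : E2) : ℝ := 4 * (‖y‖ ^ 2 + 4)⁻¹

theorem conf_pos (y : E2) : 0 < conf y := by unfold conf; positivity

theorem conf_zero : conf 0 = 1 := by norm_num [conf]

theorem conf_mul (y : E2) : conf y * (‖y‖ ^ 2 + 4) = 4 := by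
  unfold conf; field_simp

/-- The chart centred at `p` is the stereographic projection from the antipode `-p`. -/
theorem chartAt_self (p : S2) : chartAt E2 p p = 0 := by
  have : Fact (Module.finrank ℝ E3 = 2 + 1) := ⟨by simp⟩
  change stereographic' 2 (-p) p = 0
  simp only [stereographic', OpenPartialHomeomorph.coe_trans, Function.comp_apply,
    stereographic_neg_apply]
  exact map_zero (OrthonormalBasis.fromOrthogonalSpanSingleton 2
    (ne_zero_of_mem_unit_sphere (-p))).repr

/-- `ι` identifies the plane with the orthogonal complement of `p`. The coefficient of `p` in the
inverse projection is `(4 - ‖y‖²) / (4 + ‖y‖²)`, which is `2 * conf y - 1`. -/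
theorem exists_param_eq (p : S2) : ∃ ι : E2 →ₗᵢ[ℝ] E3, (∀ y, inner ℝ (ι y) (p : E3) = 0) ∧
    ∀ y, (param p y : E3) = conf y • ι y + (2 * conf y - 1) • (p : E3) := by
  have : Fact (Module.finrank ℝ E3 = 2 + 1) := ⟨by simp⟩
  let U := (OrthonormalBasis.fromOrthogonalSpanSingleton (𝕜 := ℝ) 2
    (ne_zero_of_mem_unit_sphere (-p))).repr
  refine ⟨(Submodule.subtypeₗᵢ _).comp U.symm.toLinearIsometry, fun y => ?_, fun y => ?_⟩
  · have := (Submodule.mem_orthogonal_singleton_iff_inner_left).1 (U.symm y).2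
    change inner ℝ (U.symm y).1 (p : E3) = 0
    simpa using this
  · have hn : ‖(U.symm y).1‖ = ‖y‖ := U.symm.norm_map y
    have h4 : ‖y‖ ^ 2 + 4 ≠ 0 := by positivity
    change ((stereographic' 2 (-p)).symm y : E3) = conf y • (U.symm y).1 + _
    refine (stereographic'_symm_apply (n := 2) (-p) y).trans ?_
    change (‖(U.symm y).1‖ ^ 2 + 4)⁻¹ • (4 : ℝ) • (U.symm y).1 +
      (‖(U.symm y).1‖ ^ 2 + 4)⁻¹ • (‖(U.symm y).1‖ ^ 2 - 4) • (-(p : E3)) = _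
    rw [hn, conf]
    match_scalars <;> field_simp
    ring

theorem hasFDerivAt_conf (y : E2) :
    HasFDerivAt conf (-(conf y ^ 2 / 2) • innerSL ℝ y) y := by
  have h4 : ‖y‖ ^ 2 + 4 ≠ 0 := by positivity
  have h0 : HasFDerivAt (fun w : E2 => ‖w‖ ^ 2 + 4) ((2 : ℕ) • innerSL ℝ y) y :=
    ((hasStrictFDerivAt_norm_sq y).hasFDerivAt).add_const 4
  have h1 := ((hasDerivAt_inv h4).comp_hasFDerivAt y h0).const_mul 4
  refine h1.congr_fderiv ?_
  ext v
  simp [conf]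
  field_simp
  ring

/-- The differential of the inverse stereographic chart, when the chart is centred at `p` and the
tangent plane is parametrized by `ι`. -/
def paramDeriv (ι : E2 →ₗᵢ[ℝ] E3) (p : E3) (y v : E2) : E3 :=
  conf y • ι v + (-(1 / 2) * conf y ^ 2 * inner ℝ y v) • (ι y + (2 : ℝ) • p)

theorem hasFDerivAt_param {ι : E2 →ₗᵢ[ℝ] E3} {p : S2}
    (hX : ∀ y, (param p y : E3) = conf y • ι y + (2 * conf y - 1) • (p : E3)) (y : E2) :
    DifferentiableAt ℝ (fun z => (param p z : E3)) y ∧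
      ∀ v, fderiv ℝ (fun z => (param p z : E3)) y v = paramDeriv ι p y v := by
  have hc := hasFDerivAt_conf y
  have h := (hc.smul ι.toContinuousLinearMap.hasFDerivAt).add
    (((hc.const_mul 2).sub_const 1).smul_const (p : E3))
  have h' : HasFDerivAt (fun z => (param p z : E3)) _ y :=
    h.congr_of_eventuallyEq (Filter.Eventually.of_forall hX)
  refine ⟨h'.differentiableAt, fun v => ?_⟩
  rw [h'.fderiv]
  simp [paramDeriv]
  module

/-- Conformality of the stereographic projection: the terms containing `inner ℝ y v * inner ℝ y w`
cancel because `conf y * (‖y‖² + 4) = 4`. -/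
theorem inner_paramDeriv {ι : E2 →ₗᵢ[ℝ] E3} {p : S2} (hp : ∀ y, inner ℝ (ι y) (p : E3) = 0)
    (y v w : E2) :
    inner ℝ (paramDeriv ι p y v) (paramDeriv ι p y w) = conf y ^ 2 * inner ℝ v w := by
  have hp' : ∀ y, inner ℝ (p : E3) (ι y) = 0 := fun y => by rw [real_inner_comm, hp]
  have h1 : inner ℝ (p : E3) (p : E3) = 1 := by simp
  have hc := conf_mul y
  simp only [paramDeriv, inner_add_left, inner_add_right, real_inner_smul_left,
    real_inner_smul_right, hp, hp', h1, LinearIsometry.inner_map_map, real_inner_self_eq_norm_sq]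
  rw [real_inner_comm y v]
  linear_combination (inner ℝ y v * inner ℝ y w * conf y ^ 3 / 4) * hc

theorem metricMatrix_eq (p : S2) (y : E2) : metricMatrix p y = (conf y ^ 2) • 1 := by
  obtain ⟨ι, hp, hX⟩ := exists_param_eq p
  ext i j
  simp only [metricMatrix, partialDeriv, (hasFDerivAt_param hX y).2, inner_paramDeriv hp]
  fin_cases i <;> fin_cases j <;> simp [EuclideanSpace.inner_single_left]

/-- In dimension two a conformal metric satisfies `√(det g) g⁻¹ = 1`, so the inner factors disappear
and only `(det g)^{-1/2}` remains; it is 1 at the centre of the chart. -/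
theorem laplaceBeltrami_eq (u : S2 → ℂ) (p : S2) :
    laplaceBeltrami u p =
      ∑ i, partialDeriv i (fun y => partialDeriv i (fun z => u (param p z)) y) 0 := by
  have hdet : ∀ y, √(metricMatrix p y).det = conf y ^ 2 := fun y => by
    rw [metricMatrix_eq, Matrix.det_smul]
    simpa using Real.sqrt_sq (sq_nonneg (conf y))
  have hinv : ∀ y, (metricMatrix p y)⁻¹ = (conf y ^ 2)⁻¹ • 1 := fun y => by
    rw [metricMatrix_eq]
    refine Matrix.inv_eq_left_inv ?_
    rw [smul_mul_smul_comm, inv_mul_cancel₀ (pow_pos (conf_pos y) 2).ne', one_mul, one_smul]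
  simp only [laplaceBeltrami, chartAt_self, hdet, hinv, conf_zero]
  have key : ∀ i : Fin 2, (fun y => conf y ^ 2 • ∑ j, ((conf y ^ 2)⁻¹ • (1 : Matrix _ _ ℝ)) i j •
      partialDeriv j (fun z => u (param p z)) y) =
      fun y => partialDeriv i (fun z => u (param p z)) y := fun i => by
    funext y
    have := (conf_pos y).ne'
    fin_cases i <;> simp [Fin.sum_univ_two, this]
  simp only [key]
  simp

/-! ### The operator in Cartesian coordinates -/

/-- The partial derivative of a function on `ℝ³`. -/
def pd (i : Fin 3) (φ : E3 → ℂ) (x : E3) : ℂ := fderiv ℝ φ x (EuclideanSpace.single i 1)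

/-- To second order at the origin, `param p y` is `p + ι y - (‖y‖² / 2) p`. The linear term yields
the Hessian of `φ`, the quadratic one the normal derivative, which reflects the curvature of the
sphere. -/
theorem partialDeriv_partialDeriv_comp_param {φ : E3 → ℂ} (hφ : ContDiff ℝ 2 φ) (r : ℝ)
    {ι : E2 →ₗᵢ[ℝ] E3} {p : S2}
    (hX : ∀ y, (param p y : E3) = conf y • ι y + (2 * conf y - 1) • (p : E3)) (i : Fin 2) :
    partialDeriv i (fun y => partialDeriv i (fun z => φ (r • (param p z : E3))) y) 0 =
      r ^ 2 • fderiv ℝ (fderiv ℝ φ) (r • p) (ι (EuclideanSpace.single i 1))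
        (ι (EuclideanSpace.single i 1)) - r • fderiv ℝ φ (r • p) p := by
  set e : E2 := EuclideanSpace.single i 1 with he
  have hee : ‖e‖ = 1 := by simp [he]
  have hd : Differentiable ℝ φ := hφ.differentiable (by norm_num)
  have hd2 : Differentiable ℝ (fderiv ℝ φ) :=
    (hφ.fderiv_right (m := 1) (by norm_num)).differentiable (by norm_num)
  have hparam0 : (param p 0 : E3) = p := by rw [hX, conf_zero]; norm_num
  have hpart : ∀ y, partialDeriv i (fun z => φ (r • (param p z : E3))) y =
      fderiv ℝ φ (r • (param p y : E3)) (r • paramDeriv ι p y e) := fun y => by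
    obtain ⟨h1, h2⟩ := hasFDerivAt_param hX y
    have hr : HasFDerivAt (fun z => r • (param p z : E3)) _ y := h1.hasFDerivAt.const_smul r
    have := ((hd (r • (param p y : E3))).hasFDerivAt).comp y hr
    rw [partialDeriv, show (fun z => φ (r • (param p z : E3))) = φ ∘ fun z => r • (param p z : E3)
      from rfl, this.fderiv]
    simp [h2, he]
  have hX0 : HasFDerivAt (fun z => r • (param p z : E3)) _ 0 :=
    (hasFDerivAt_param hX 0).1.hasFDerivAt.const_smul r
  have hc := hasFDerivAt_conf 0
  have hin : HasFDerivAt (fun y : E2 => inner ℝ y e) (innerSL ℝ e) 0 := by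
    have := (innerSL ℝ e).hasFDerivAt (x := (0 : E2))
    refine this.congr_of_eventuallyEq (Filter.Eventually.of_forall fun y => ?_)
    simp [real_inner_comm]
  have hι := ι.toContinuousLinearMap.hasFDerivAt (x := 0) |>.add_const ((2 : ℝ) • (p : E3))
  have hcoef := ((hc.pow 2).const_mul (-(1 / 2))).mul hin
  have hpd : HasFDerivAt (fun y => r • paramDeriv ι p y e) _ 0 :=
    ((hc.smul_const (ι e)).add (hcoef.smul hι)).const_smul r
  have hφ2 : HasFDerivAt (fun y => fderiv ℝ φ (r • (param p y : E3))) _ 0 :=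
    (hd2 (r • (param p 0 : E3))).hasFDerivAt.comp 0 hX0
  have hfin := hφ2.clm_apply hpd
  simp only [hpart]
  rw [partialDeriv, hfin.fderiv]
  simp [(hasFDerivAt_param hX 0).2, hparam0, paramDeriv, conf_zero, ← he, hee]
  ring

/-- Both sums are the trace of the Hessian, that is, the Laplacian. -/
theorem sum_fderiv_fderiv_eq (φ : E3 → ℂ) (x : E3) {ι κ : Type*} [Fintype ι] [Fintype κ]
    (b : OrthonormalBasis ι ℝ E3) (c : OrthonormalBasis κ ℝ E3) :
    ∑ i, fderiv ℝ (fderiv ℝ φ) x (b i) (b i) = ∑ i, fderiv ℝ (fderiv ℝ φ) x (c i) (c i) := by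
  have h1 := congrFun (InnerProductSpace.laplacian_eq_iteratedFDeriv_orthonormalBasis φ b) x
  have h2 := congrFun (InnerProductSpace.laplacian_eq_iteratedFDeriv_orthonormalBasis φ c) x
  simp only [iteratedFDeriv_two_apply] at h1 h2
  simpa using h1.symm.trans h2

theorem pd_pd {φ : E3 → ℂ} (hφ : ContDiff ℝ 2 φ) (i j : Fin 3) (x : E3) :
    pd i (pd j φ) x =
      fderiv ℝ (fderiv ℝ φ) x (EuclideanSpace.single i 1) (EuclideanSpace.single j 1) := by
  have hd2 : Differentiable ℝ (fderiv ℝ φ) :=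
    (hφ.fderiv_right (m := 1) (by norm_num)).differentiable (by norm_num)
  have := (hd2 x).hasFDerivAt.clm_apply
    (hasFDerivAt_const (EuclideanSpace.single j (1 : ℝ) : E3) x)
  unfold pd
  rw [this.fderiv]
  simp

theorem eq_sum_single (x : E3) : x = ∑ i, x i • (EuclideanSpace.single i (1 : ℝ) : E3) := by
  ext k
  simp [Finset.sum_apply, Pi.single_apply]

theorem fderiv_self {φ : E3 → ℂ} (x : E3) : fderiv ℝ φ x x = ∑ i, x i • pd i φ x := by
  unfold pd
  generalize fderiv ℝ φ x = B
  conv_lhs => rw [eq_sum_single x]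
  simp only [map_sum, map_smul]

theorem fderiv_fderiv_self {φ : E3 → ℂ} (hφ : ContDiff ℝ 2 φ) (x : E3) :
    fderiv ℝ (fderiv ℝ φ) x x x = ∑ i, ∑ j, (x i * x j) • pd i (pd j φ) x := by
  simp only [pd_pd hφ]
  generalize fderiv ℝ (fderiv ℝ φ) x = B
  conv_lhs => rw [eq_sum_single x]
  simp only [map_sum, _root_.sum_apply, map_smul, _root_.smul_apply,
    Finset.smul_sum, smul_smul]
  rw [Finset.sum_comm]
  simp only [mul_comm]

theorem exists_orthonormalBasis {ι : E2 →ₗᵢ[ℝ] E3} {p : E3} (hp1 : ‖p‖ = 1)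
    (hp : ∀ y, inner ℝ (ι y) p = 0) : ∃ b : OrthonormalBasis (Fin 3) ℝ E3,
      b 0 = ι (EuclideanSpace.single 0 1) ∧ b 1 = ι (EuclideanSpace.single 1 1) ∧ b 2 = p := by
  have hp' : ∀ y, inner ℝ p (ι y) = 0 := fun y => by rw [real_inner_comm, hp]
  let v : Fin 3 → E3 := ![ι (EuclideanSpace.single 0 1), ι (EuclideanSpace.single 1 1), p]
  have hv : Orthonormal ℝ v := by
    constructor
    · intro i
      fin_cases i <;> simp [v, hp1]
    · intro i j hij
      fin_cases i <;> fin_cases j <;> simp [v, hp, hp', EuclideanSpace.inner_single_left] at hij ⊢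
  have hc : Fintype.card (Fin 3) = Module.finrank ℝ E3 := by simp
  have hb : ∀ i, (basisOfOrthonormalOfCardEqFinrank hv hc).toOrthonormalBasis
      (by rwa [coe_basisOfOrthonormalOfCardEqFinrank]) i = v i := by simp
  exact ⟨_, hb 0, hb 1, hb 2⟩

/-- The operator `Δ_{S²} / |x|²` in Cartesian coordinates. -/
theorem angular_eq {φ : E3 → ℂ} (hφ : ContDiff ℝ 2 φ) {x : E3} (hx : x ≠ 0) :
    angular φ x = ∑ i, pd i (pd i φ) x
      - (‖x‖ ^ 2)⁻¹ • ∑ i, ∑ j, (x i * x j) • pd i (pd j φ) x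
      - (2 * (‖x‖ ^ 2)⁻¹) • ∑ i, x i • pd i φ x := by
  set p := direction x hx with hp
  have hr : ‖x‖ ≠ 0 := norm_ne_zero_iff.2 hx
  have hpx : (p : E3) = ‖x‖⁻¹ • x := rfl
  have hrp : ‖x‖ • (p : E3) = x := by rw [hpx, smul_smul, mul_inv_cancel₀ hr, one_smul]
  obtain ⟨ι, h1, h2⟩ := exists_param_eq p
  obtain ⟨b, hb0, hb1, hb2⟩ := exists_orthonormalBasis (by simp) h1
  -- In the basis adapted to `p`, the tangential part of the Hessian is the full Laplacian minus the
  -- entry in direction `p`. The two tangential directions each contribute one `-r ∂_p φ`, whence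
  -- the factor 2 in front of the first-order term.
  have htr := sum_fderiv_fderiv_eq φ x b (EuclideanSpace.basisFun (Fin 3) ℝ)
  rw [Fin.sum_univ_three, hb0, hb1, hb2] at htr
  rw [← fderiv_self, ← fderiv_fderiv_self hφ]
  simp only [pd_pd hφ]
  simp only [EuclideanSpace.basisFun_apply] at htr
  rw [← htr, angular, dif_neg hx, laplaceBeltrami_eq]
  simp only [← hp, partialDeriv_partialDeriv_comp_param hφ ‖x‖ h2, hrp, Fin.sum_univ_two]
  rw [hpx]
  simp only [map_smul, _root_.smul_apply]
  match_scalars <;> field_simp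
  all_goals ring

end SphericalHardy

namespace SphericalHardy

open ComplexConjugate

/-! ### Calculus of test functions -/

/-- Membership in `C_c^∞(ℝ³)`. -/
structure IsTest (φ : E3 → ℂ) : Prop where
  contDiff : ContDiff ℝ ∞ φ
  hasCompactSupport : HasCompactSupport φ

theorem contDiff_pd {φ : E3 → ℂ} (hφ : ContDiff ℝ ∞ φ) (i : Fin 3) : ContDiff ℝ ∞ (pd i φ) :=
  (hφ.fderiv_right (m := ∞) (by simp)).clm_apply contDiff_const

theorem differentiable_of_contDiff {φ : E3 → ℂ} (hφ : ContDiff ℝ ∞ φ) : Differentiable ℝ φ :=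
  hφ.differentiable (by simp)

theorem contDiff_two {φ : E3 → ℂ} (hφ : ContDiff ℝ ∞ φ) : ContDiff ℝ 2 φ :=
  hφ.of_le (by norm_cast)

theorem IsTest.pderiv {φ : E3 → ℂ} (hφ : IsTest φ) (i : Fin 3) : IsTest (pd i φ) :=
  ⟨contDiff_pd hφ.1 i, hφ.2.fderiv_apply ℝ _⟩

theorem IsTest.mul_left {φ g : E3 → ℂ} (hφ : IsTest φ) (hg : ContDiff ℝ ∞ g) :
    IsTest (fun x => g x * φ x) := ⟨hg.mul hφ.1, hφ.2.mul_left⟩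

theorem IsTest.mul_right {φ g : E3 → ℂ} (hφ : IsTest φ) (hg : ContDiff ℝ ∞ g) :
    IsTest (fun x => φ x * g x) := ⟨hφ.1.mul hg, hφ.2.mul_right⟩

theorem IsTest.sub {φ ψ : E3 → ℂ} (hφ : IsTest φ) (hψ : IsTest ψ) :
    IsTest (fun x => φ x - ψ x) := ⟨hφ.1.sub hψ.1, hφ.2.sub hψ.2⟩

theorem contDiff_conj {φ : E3 → ℂ} (hφ : ContDiff ℝ ∞ φ) : ContDiff ℝ ∞ (fun x => conj (φ x)) :=
  Complex.conjCLE.contDiff.comp hφ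

theorem IsTest.integrable {φ : E3 → ℂ} (hφ : IsTest φ) : Integrable φ :=
  hφ.1.continuous.integrable_of_hasCompactSupport hφ.2

theorem IsTest.integrable_norm_sq {φ : E3 → ℂ} (hφ : IsTest φ) :
    Integrable fun x => ‖φ x‖ ^ 2 := by
  have h1 : Continuous fun x => ‖φ x‖ ^ 2 := hφ.1.continuous.norm.pow 2
  have h2 : HasCompactSupport fun x => ‖φ x‖ ^ 2 := by
    simp only [pow_two]
    exact hφ.2.norm.mul_right
  exact h1.integrable_of_hasCompactSupport h2

theorem pd_mul {f g : E3 → ℂ} (hf : ContDiff ℝ ∞ f) (hg : ContDiff ℝ ∞ g) (i : Fin 3) (x : E3) :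
    pd i (fun x => f x * g x) x = f x * pd i g x + pd i f x * g x := by
  unfold pd
  rw [fderiv_fun_mul (differentiable_of_contDiff hf x) (differentiable_of_contDiff hg x)]
  simp [mul_comm]

theorem pd_sub {f g : E3 → ℂ} (hf : ContDiff ℝ ∞ f) (hg : ContDiff ℝ ∞ g) (i : Fin 3) (x : E3) :
    pd i (fun x => f x - g x) x = pd i f x - pd i g x := by
  unfold pd
  rw [fderiv_fun_sub (differentiable_of_contDiff hf x) (differentiable_of_contDiff hg x)]
  simp

theorem pd_conj {f : E3 → ℂ} (hf : ContDiff ℝ ∞ f) (i : Fin 3) :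
    pd i (fun x => conj (f x)) = fun x => conj (pd i f x) := by
  funext x
  have := Complex.conjCLE.toContinuousLinearMap.hasFDerivAt.comp x
    (differentiable_of_contDiff hf x).hasFDerivAt
  have h : HasFDerivAt (fun x => conj (f x)) _ x := this
  unfold pd
  rw [h.fderiv]
  simp

theorem pd_comm {f : E3 → ℂ} (hf : ContDiff ℝ ∞ f) (i j : Fin 3) :
    pd i (pd j f) = pd j (pd i f) := by
  funext x
  rw [pd_pd (contDiff_two hf), pd_pd (contDiff_two hf)]
  exact ((contDiff_two hf).contDiffAt.isSymmSndFDerivAt (by simp)) _ _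

theorem IsTest.integral_pd_mul {f g : E3 → ℂ} (hf : IsTest f) (hg : ContDiff ℝ ∞ g) (i : Fin 3) :
    ∫ x, pd i f x * g x = -∫ x, f x * pd i g x := by
  have := integral_mul_fderiv_eq_neg_fderiv_mul_of_integrable (μ := (volume : Measure E3))
    (f := f) (g := g) (v := EuclideanSpace.single i 1)
    ((hf.pderiv i).mul_right hg).integrable (hf.mul_right (contDiff_pd hg i)).integrable
    (hf.mul_right hg).integrable (fun x _ => differentiable_of_contDiff hf.1 x)
    (fun x _ => differentiable_of_contDiff hg x)
  unfold pd
  rw [this, neg_neg]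

theorem IsTest.integral_pd {f : E3 → ℂ} (hf : IsTest f) (i : Fin 3) : ∫ x, pd i f x = 0 := by
  have := hf.integral_pd_mul (g := fun _ => 1) contDiff_const i
  simpa [pd] using this

/-! ### The Hessian is controlled by the Laplacian -/

/-- The Laplacian in Cartesian coordinates. -/
def lapl (φ : E3 → ℂ) (x : E3) : ℂ := ∑ i, pd i (pd i φ) x

theorem contDiff_lapl {φ : E3 → ℂ} (hφ : ContDiff ℝ ∞ φ) : ContDiff ℝ ∞ (lapl φ) :=
  ContDiff.sum fun i _ => contDiff_pd (contDiff_pd hφ i) i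

theorem IsTest.laplacian {φ : E3 → ℂ} (hφ : IsTest φ) : IsTest (lapl φ) := by
  refine ⟨contDiff_lapl hφ.1, ?_⟩
  have h : lapl φ = fun x => pd 0 (pd 0 φ) x +
      pd 1 (pd 1 φ) x + pd 2 (pd 2 φ) x := by
    funext x; simp [lapl, Fin.sum_univ_three]
  rw [h]
  exact (((hφ.pderiv 0).pderiv 0).2.add ((hφ.pderiv 1).pderiv 1).2).add ((hφ.pderiv 2).pderiv 2).2

/-- Moving `∂_i` to the conjugate factor and then `∂_j` back costs two signs; the derivatives
commute in between. -/
theorem integral_pd_pd_mul_conj {φ : E3 → ℂ} (hφ : IsTest φ) (i j : Fin 3) :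
    ∫ x, pd i (pd j φ) x * conj (pd i (pd j φ) x) =
      ∫ x, pd j (pd j φ) x * conj (pd i (pd i φ) x) := by
  have hc := contDiff_conj hφ.1
  have h2 : ∀ k l, pd k (pd l (fun x => conj (φ x))) = fun x => conj (pd k (pd l φ) x) :=
    fun k l => by rw [pd_conj hφ.1, pd_conj (contDiff_pd hφ.1 l)]
  have h1 := (hφ.pderiv j).integral_pd_mul (contDiff_pd (contDiff_pd hc j) i) i
  have h3 := (hφ.pderiv j).integral_pd_mul (contDiff_pd (contDiff_pd hc i) i) j
  rw [pd_comm hc i j, pd_comm (contDiff_pd hc i) i j, ← h3] at h1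
  simpa only [h2, pd_comm hφ.1 j i] using h1

/-- Summing the exchange of derivatives over `i` and `j` turns the Hessian entries into the
expansion of `Δφ` times its conjugate. -/
theorem integral_hessian {φ : E3 → ℂ} (hφ : IsTest φ) :
    ∫ x, ∑ i, ∑ j, ‖pd i (pd j φ) x‖ ^ 2 = ∫ x, ‖lapl φ x‖ ^ 2 := by
  apply Complex.ofReal_injective
  rw [← integral_complex_ofReal, ← integral_complex_ofReal]
  have hI : ∀ i j, Integrable fun x => pd i (pd j φ) x * conj (pd i (pd j φ) x) := fun i j =>
    (((hφ.pderiv j).pderiv i).mul_right (contDiff_conj ((hφ.pderiv j).pderiv i).1)).integrable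
  have hJ : ∀ i j, Integrable fun x => pd j (pd j φ) x * conj (pd i (pd i φ) x) := fun i j =>
    (((hφ.pderiv j).pderiv j).mul_right (contDiff_conj ((hφ.pderiv i).pderiv i).1)).integrable
  have e1 : ∀ x, ((∑ i, ∑ j, ‖pd i (pd j φ) x‖ ^ 2 : ℝ) : ℂ) =
      ∑ i, ∑ j, pd i (pd j φ) x * conj (pd i (pd j φ) x) := fun x => by
    push_cast
    simp only [Complex.mul_conj']
  have e2 : ∀ x, ((‖lapl φ x‖ ^ 2 : ℝ) : ℂ) =
      ∑ i, ∑ j, pd j (pd j φ) x * conj (pd i (pd i φ) x) := fun x => by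
    push_cast
    rw [← Complex.mul_conj', lapl, map_sum, Finset.sum_mul_sum, Finset.sum_comm]
  simp only [e1, e2]
  rw [integral_finsetSum _ fun i _ => integrable_finsetSum _ fun j _ => hI i j,
    integral_finsetSum _ fun i _ => integrable_finsetSum _ fun j _ => hJ i j]
  refine Finset.sum_congr rfl fun i _ => ?_
  rw [integral_finsetSum _ fun j _ => hI i j, integral_finsetSum _ fun j _ => hJ i j]
  exact Finset.sum_congr rfl fun j _ => integral_pd_pd_mul_conj hφ i j

end SphericalHardy

namespace SphericalHardy

open ComplexConjugate

/-! ### Hardy's inequality -/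

/-- The coordinate functions, with complex values. -/
def coord (k : Fin 3) (x : E3) : ℂ := ((x k : ℝ) : ℂ)

theorem hasFDerivAt_coord (k : Fin 3) (x : E3) :
    HasFDerivAt (coord k) (Complex.ofRealCLM.comp (EuclideanSpace.proj k : E3 →L[ℝ] ℝ)) x :=
  (Complex.ofRealCLM.comp (EuclideanSpace.proj k : E3 →L[ℝ] ℝ)).hasFDerivAt

theorem contDiff_coord (k : Fin 3) : ContDiff ℝ ∞ (coord k) :=
  (Complex.ofRealCLM.comp (EuclideanSpace.proj k : E3 →L[ℝ] ℝ)).contDiff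

theorem pd_coord (i k : Fin 3) (x : E3) : pd i (coord k) x = if k = i then 1 else 0 := by
  rw [pd, (hasFDerivAt_coord k x).fderiv]
  simp
  split_ifs <;> simp

/-- The field `x / (|x|² + ε)`, a regularization of `x / |x|²`. -/
def hardyField (ε : ℝ) (k : Fin 3) (x : E3) : ℂ := ((x k * (‖x‖ ^ 2 + ε)⁻¹ : ℝ) : ℂ)

theorem contDiff_hardyField {ε : ℝ} (hε : 0 < ε) (k : Fin 3) : ContDiff ℝ ∞ (hardyField ε k) := by
  refine Complex.ofRealCLM.contDiff.comp (ContDiff.mul ?_ (ContDiff.inv ?_ fun x => by positivity))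
  · exact (EuclideanSpace.proj k : E3 →L[ℝ] ℝ).contDiff
  · exact (contDiff_norm_sq ℝ).add contDiff_const

theorem pd_hardyField {ε : ℝ} (hε : 0 < ε) (k : Fin 3) (x : E3) :
    pd k (hardyField ε k) x =
      (((‖x‖ ^ 2 + ε)⁻¹ - 2 * x k ^ 2 * ((‖x‖ ^ 2 + ε)⁻¹) ^ 2 : ℝ) : ℂ) := by
  have h4 : ‖x‖ ^ 2 + ε ≠ 0 := by positivity
  have h0 : HasFDerivAt (fun w : E3 => ‖w‖ ^ 2 + ε) ((2 : ℕ) • innerSL ℝ x) x :=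
    ((hasStrictFDerivAt_norm_sq x).hasFDerivAt).add_const ε
  have h1 := ((EuclideanSpace.proj k : E3 →L[ℝ] ℝ).hasFDerivAt (x := x)).mul
    ((hasDerivAt_inv h4).comp_hasFDerivAt x h0)
  have h2 : HasFDerivAt (hardyField ε k) _ x := Complex.ofRealCLM.hasFDerivAt.comp x h1
  rw [pd, h2.fderiv]
  simp [EuclideanSpace.inner_single_right]
  ring

theorem norm_sq_eq_sum (x : E3) : ‖x‖ ^ 2 = ∑ k, x k ^ 2 := by
  simp [EuclideanSpace.norm_sq_eq]

/-- The divergence of `|ψ|² x / (|x|² + ε)` contains a positive multiple of `|ψ|² / (|x|² + ε)`, and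
Young's inequality absorbs the cross term with `∇ψ`. The regularization makes the field smooth at
the origin. -/
theorem hardy_pointwise {ψ : E3 → ℂ} (hψ : ContDiff ℝ ∞ ψ) {ε : ℝ} (hε : 0 < ε) (x : E3) :
    2⁻¹ * (‖ψ x‖ ^ 2 * (‖x‖ ^ 2 + ε)⁻¹) - 2 * ∑ k, ‖pd k ψ x‖ ^ 2 ≤
      (∑ k, pd k (fun y => hardyField ε k y * (ψ y * conj (ψ y))) x).re := by
  have hc := contDiff_conj hψ
  set ρ := (‖x‖ ^ 2 + ε)⁻¹ with hρ
  have hρ0 : 0 < ρ := by positivity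
  have hρ1 : ‖x‖ ^ 2 * ρ ≤ 1 := by
    rw [hρ, mul_inv_le_iff₀ (by positivity)]; linarith
  have hk : ∀ k, (pd k (fun y => hardyField ε k y * (ψ y * conj (ψ y))) x).re =
      (ρ - 2 * x k ^ 2 * ρ ^ 2) * ‖ψ x‖ ^ 2 + 2 * (x k * ρ) * (pd k ψ x * conj (ψ x)).re := by
    intro k
    rw [pd_mul (contDiff_hardyField hε k) (hψ.mul hc), pd_mul hψ hc, pd_hardyField hε, ← hρ,
      Complex.mul_conj', pd_conj hψ, hardyField, ← hρ, Complex.add_re, Complex.re_ofReal_mul,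
      Complex.re_ofReal_mul, Complex.add_re, ← Complex.ofReal_pow, Complex.ofReal_re]
    simp only [Complex.mul_re, Complex.conj_re, Complex.conj_im]
    ring
  have hkl : ∀ k, (ρ - 2 * x k ^ 2 * ρ ^ 2) * ‖ψ x‖ ^ 2
      - (2⁻¹ * (x k ^ 2 * ρ ^ 2 * ‖ψ x‖ ^ 2) + 2 * ‖pd k ψ x‖ ^ 2) ≤
      (pd k (fun y => hardyField ε k y * (ψ y * conj (ψ y))) x).re := by
    intro k
    rw [hk]
    have h1 : |(pd k ψ x * conj (ψ x)).re| ≤ ‖pd k ψ x‖ * ‖ψ x‖ := by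
      refine (Complex.abs_re_le_norm _).trans ?_
      rw [norm_mul, Complex.norm_conj]
    have h2 : |2 * (x k * ρ) * (pd k ψ x * conj (ψ x)).re| ≤
        2 * (|x k| * ρ) * (‖pd k ψ x‖ * ‖ψ x‖) := by
      rw [abs_mul, abs_mul, abs_mul, abs_of_pos hρ0, abs_two]
      gcongr
    have h3 := neg_abs_le (2 * (x k * ρ) * (pd k ψ x * conj (ψ x)).re)
    -- Young's inequality `2ab ≤ a² / 2 + 2b²`; this weight leads to the constant 4 in Hardy's
    -- inequality.
    have h4 := sq_nonneg (|x k| * ρ * ‖ψ x‖ - 2 * ‖pd k ψ x‖)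
    have h5 := sq_abs (x k)
    rw [← h5]
    nlinarith
  rw [Complex.re_sum]
  refine le_trans ?_ (Finset.sum_le_sum fun k _ => hkl k)
  have hsum : ∑ k, ((ρ - 2 * x k ^ 2 * ρ ^ 2) * ‖ψ x‖ ^ 2
      - (2⁻¹ * (x k ^ 2 * ρ ^ 2 * ‖ψ x‖ ^ 2) + 2 * ‖pd k ψ x‖ ^ 2)) =
      (3 * ρ - 5 / 2 * (‖x‖ ^ 2 * ρ) * ρ) * ‖ψ x‖ ^ 2 - 2 * ∑ k, ‖pd k ψ x‖ ^ 2 := by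
    rw [norm_sq_eq_sum x]
    simp only [Fin.sum_univ_three]
    ring
  rw [hsum]
  -- Since `‖x‖² * ρ ≤ 1`, the coefficient is at least `(3 - 5/2) ρ = ρ / 2`.
  have h6 : 0 ≤ ρ * ‖ψ x‖ ^ 2 := by positivity
  nlinarith

theorem IsTest.integrable_norm_sq_mul_inv {ψ : E3 → ℂ} (hψ : IsTest ψ) {ε : ℝ} (hε : 0 < ε) :
    Integrable fun x => ‖ψ x‖ ^ 2 * (‖x‖ ^ 2 + ε)⁻¹ := by
  refine Integrable.mul_bdd (c := ε⁻¹) hψ.integrable_norm_sq ?_ ?_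
  · exact (Continuous.inv₀ (by fun_prop) fun x => by positivity).aestronglyMeasurable
  · refine Filter.Eventually.of_forall fun x => ?_
    rw [Real.norm_of_nonneg (by positivity)]
    gcongr
    nlinarith [sq_nonneg ‖x‖]

/-- A divergence of compactly supported fields integrates to zero, so the pointwise bound gives
`(1/2) ∫ |ψ|² / (|x|² + ε) ≤ 2 ∫ |∇ψ|²`, uniformly in `ε`. -/
theorem hardy_regularized {ψ : E3 → ℂ} (hψ : IsTest ψ) {ε : ℝ} (hε : 0 < ε) :
    ∫ x, ‖ψ x‖ ^ 2 * (‖x‖ ^ 2 + ε)⁻¹ ≤ 4 * ∫ x, ∑ k, ‖pd k ψ x‖ ^ 2 := by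
  have hF : ∀ k, IsTest fun y => hardyField ε k y * (ψ y * conj (ψ y)) := fun k =>
    (hψ.mul_right (contDiff_conj hψ.1)).mul_left (contDiff_hardyField hε k)
  have hint : Integrable fun x => ∑ k, pd k (fun y => hardyField ε k y * (ψ y * conj (ψ y))) x :=
    integrable_finsetSum _ fun k _ => ((hF k).pderiv k).integrable
  have h0 : ∫ x, ∑ k, pd k (fun y => hardyField ε k y * (ψ y * conj (ψ y))) x = 0 := by
    rw [integral_finsetSum _ fun k _ => ((hF k).pderiv k).integrable]
    simp [(hF _).integral_pd]
  have h1 := hψ.integrable_norm_sq_mul_inv hε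
  have h2 : Integrable fun x => ∑ k, ‖pd k ψ x‖ ^ 2 :=
    integrable_finsetSum _ fun k _ => (hψ.pderiv k).integrable_norm_sq
  have h3 := integral_mono ((h1.const_mul 2⁻¹).sub (h2.const_mul 2)) hint.re
    (hardy_pointwise hψ.1 hε)
  have h4 : ∫ x, RCLike.re (∑ k, pd k (fun y => hardyField ε k y * (ψ y * conj (ψ y))) x) = 0 := by
    rw [integral_re hint, h0]; simp
  have h5 : ∫ x, (2⁻¹ * (‖ψ x‖ ^ 2 * (‖x‖ ^ 2 + ε)⁻¹) - 2 * ∑ k, ‖pd k ψ x‖ ^ 2) =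
      2⁻¹ * (∫ x, ‖ψ x‖ ^ 2 * (‖x‖ ^ 2 + ε)⁻¹) - 2 * ∫ x, ∑ k, ‖pd k ψ x‖ ^ 2 := by
    rw [integral_sub (h1.const_mul 2⁻¹) (h2.const_mul 2), integral_const_mul, integral_const_mul]
  have h6 := (h5.symm.trans_le h3).trans_eq h4
  linarith

theorem integrable_and_integral_le_of_lintegral_le {α : Type*} [MeasurableSpace α] {μ : Measure α}
    {h : α → ℝ} (hm : AEStronglyMeasurable h μ) (h0 : ∀ x, 0 ≤ h x) {C : ℝ} (hC : 0 ≤ C)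
    (hle : ∫⁻ x, ENNReal.ofReal (h x) ∂μ ≤ ENNReal.ofReal C) :
    Integrable h μ ∧ ∫ x, h x ∂μ ≤ C := by
  refine ⟨⟨hm, ?_⟩, ?_⟩
  · rw [hasFiniteIntegral_iff_ofReal (Filter.Eventually.of_forall h0)]
    exact hle.trans_lt ENNReal.ofReal_lt_top
  · rw [integral_eq_lintegral_of_nonneg_ae (Filter.Eventually.of_forall h0) hm]
    exact ENNReal.toReal_le_of_le_ofReal hC hle

/-- Hardy's inequality in `ℝ³`. -/
theorem hardy {ψ : E3 → ℂ} (hψ : IsTest ψ) :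
    Integrable (fun x => ‖ψ x‖ ^ 2 * (‖x‖ ^ 2)⁻¹) ∧
      ∫ x, ‖ψ x‖ ^ 2 * (‖x‖ ^ 2)⁻¹ ≤ 4 * ∫ x, ∑ k, ‖pd k ψ x‖ ^ 2 := by
  have hcont := hψ.1.continuous
  have hm : Measurable fun x => ‖ψ x‖ ^ 2 * (‖x‖ ^ 2)⁻¹ := by
    have := hcont.measurable
    fun_prop
  have hC : 0 ≤ 4 * ∫ x, ∑ k, ‖pd k ψ x‖ ^ 2 := by positivity
  refine integrable_and_integral_le_of_lintegral_le hm.aestronglyMeasurable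
    (fun x => by positivity) hC ?_
  let ε : ℕ → ℝ := fun n => 1 / ((n : ℝ) + 1)
  have hε : ∀ n, 0 < ε n := fun n => by positivity
  have hε0 : Filter.Tendsto ε Filter.atTop (nhds 0) := tendsto_one_div_add_atTop_nhds_zero_nat
  have hmn : ∀ n, Measurable fun x => ‖ψ x‖ ^ 2 * (‖x‖ ^ 2 + ε n)⁻¹ := fun n => by
    have := hcont.measurable
    fun_prop
  have hlim : ∀ x : E3, x ≠ 0 → Filter.Tendsto
      (fun n => ENNReal.ofReal (‖ψ x‖ ^ 2 * (‖x‖ ^ 2 + ε n)⁻¹)) Filter.atTop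
      (nhds (ENNReal.ofReal (‖ψ x‖ ^ 2 * (‖x‖ ^ 2)⁻¹))) := fun x hx => by
    refine ENNReal.tendsto_ofReal (Filter.Tendsto.const_mul _ (Filter.Tendsto.inv₀ ?_ ?_))
    · simpa using hε0.const_add (‖x‖ ^ 2)
    · have := norm_ne_zero_iff.2 hx
      positivity
  have hae : ∀ᵐ x : E3, x ≠ 0 := by
    simp [ae_iff, measure_singleton]
  -- Fatou's lemma as `ε n → 0`; it yields integrability of the limit together with the bound.
  calc ∫⁻ x, ENNReal.ofReal (‖ψ x‖ ^ 2 * (‖x‖ ^ 2)⁻¹)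
      = ∫⁻ x, Filter.liminf (fun n => ENNReal.ofReal (‖ψ x‖ ^ 2 * (‖x‖ ^ 2 + ε n)⁻¹))
          Filter.atTop := by
        refine lintegral_congr_ae ?_
        filter_upwards [hae] with x hx using (hlim x hx).liminf_eq.symm
    _ ≤ Filter.liminf (fun n => ∫⁻ x, ENNReal.ofReal (‖ψ x‖ ^ 2 * (‖x‖ ^ 2 + ε n)⁻¹))
          Filter.atTop := lintegral_liminf_le fun n => (hmn n).ennreal_ofReal
    _ ≤ ENNReal.ofReal (4 * ∫ x, ∑ k, ‖pd k ψ x‖ ^ 2) := by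
        refine Filter.liminf_le_of_le (by isBoundedDefault) fun b hb => ?_
        obtain ⟨n, hn⟩ := hb.exists
        refine hn.trans ?_
        rw [← ofReal_integral_eq_lintegral_ofReal (hψ.integrable_norm_sq_mul_inv (hε n))
          (Filter.Eventually.of_forall fun x => by
          have hn := hε n
          positivity)]
        exact ENNReal.ofReal_le_ofReal (hardy_regularized hψ (hε n))

end SphericalHardy

namespace SphericalHardy

open ComplexConjugate

/-! ### The operator `Δ_{S²} / |x|²` on test functions -/

theorem norm_sum_coord_sq_le (x : E3) (a : Fin 3 → ℂ) :
    ‖∑ i, x i • a i‖ ^ 2 ≤ ‖x‖ ^ 2 * ∑ i, ‖a i‖ ^ 2 := by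
  calc ‖∑ i, x i • a i‖ ^ 2 ≤ (∑ i, |x i| * ‖a i‖) ^ 2 := by
        gcongr
        refine (norm_sum_le _ _).trans (le_of_eq ?_)
        simp
    _ ≤ (∑ i, |x i| ^ 2) * ∑ i, ‖a i‖ ^ 2 := Finset.sum_mul_sq_le_sq_mul_sq _ _ _
    _ = ‖x‖ ^ 2 * ∑ i, ‖a i‖ ^ 2 := by simp [norm_sq_eq_sum x]

theorem norm_sum_coord_coord_sq_le (x : E3) (a : Fin 3 → Fin 3 → ℂ) :
    ‖∑ i, ∑ j, (x i * x j) • a i j‖ ^ 2 ≤ (‖x‖ ^ 2) ^ 2 * ∑ i, ∑ j, ‖a i j‖ ^ 2 := by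
  have h : ∑ i, ∑ j, (x i * x j) • a i j = ∑ i, x i • ∑ j, x j • a i j := by
    simp only [Finset.smul_sum, smul_smul]
  rw [h]
  refine (norm_sum_coord_sq_le x _).trans ?_
  rw [pow_two (‖x‖ ^ 2), mul_assoc, Finset.mul_sum (a := ‖x‖ ^ 2) (s := Finset.univ)
    (f := fun i => ∑ j, ‖a i j‖ ^ 2)]
  gcongr with i
  exact norm_sum_coord_sq_le x _

/-- Cauchy–Schwarz bounds the radial derivatives by the Hessian and the gradient; the factor 3 is
`(a + b + c)² ≤ 3 (a² + b² + c²)`. -/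
theorem norm_angular_sq_le {φ : E3 → ℂ} (hφ : ContDiff ℝ ∞ φ) {x : E3} (hx : x ≠ 0) :
    ‖angular φ x‖ ^ 2 ≤ 3 * (‖lapl φ x‖ ^ 2 + ∑ i, ∑ j, ‖pd i (pd j φ) x‖ ^ 2 +
      4 * ∑ i, ‖pd i φ x‖ ^ 2 * (‖x‖ ^ 2)⁻¹) := by
  have hr : 0 < ‖x‖ ^ 2 := by
    have := norm_pos_iff.2 hx
    positivity
  rw [angular_eq (contDiff_two hφ) hx]
  set a := ∑ i, ∑ j, (x i * x j) • pd i (pd j φ) x with ha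
  set b := ∑ i, x i • pd i φ x with hb
  have hA : ‖(‖x‖ ^ 2)⁻¹ • a‖ ^ 2 ≤ ∑ i, ∑ j, ‖pd i (pd j φ) x‖ ^ 2 := by
    have := norm_sum_coord_coord_sq_le x fun i j => pd i (pd j φ) x
    rw [norm_smul, mul_pow, Real.norm_of_nonneg (by positivity), inv_pow,
      inv_mul_le_iff₀ (by positivity)]
    exact this
  have hB : ‖(2 * (‖x‖ ^ 2)⁻¹) • b‖ ^ 2 ≤ 4 * ∑ i, ‖pd i φ x‖ ^ 2 * (‖x‖ ^ 2)⁻¹ := by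
    have := norm_sum_coord_sq_le x fun i => pd i φ x
    rw [norm_smul, mul_pow, Real.norm_of_nonneg (by positivity), ← Finset.sum_mul]
    calc (2 * (‖x‖ ^ 2)⁻¹) ^ 2 * ‖b‖ ^ 2
        ≤ (2 * (‖x‖ ^ 2)⁻¹) ^ 2 * (‖x‖ ^ 2 * ∑ i, ‖pd i φ x‖ ^ 2) := by gcongr
      _ = _ := by field_simp; ring
  change ‖lapl φ x - _ - _‖ ^ 2 ≤ _
  set u := (‖x‖ ^ 2)⁻¹ • a
  set v := (2 * (‖x‖ ^ 2)⁻¹) • b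
  have h1 : ‖lapl φ x - u - v‖ ≤ ‖lapl φ x‖ + ‖u‖ + ‖v‖ :=
    (norm_sub_le _ _).trans (by gcongr; exact norm_sub_le _ _)
  have h2 : ‖lapl φ x - u - v‖ ^ 2 ≤ (‖lapl φ x‖ + ‖u‖ + ‖v‖) ^ 2 := by gcongr
  nlinarith [sq_nonneg (‖lapl φ x‖ - ‖u‖), sq_nonneg (‖lapl φ x‖ - ‖v‖), sq_nonneg (‖u‖ - ‖v‖)]

theorem ae_ne_zero : ∀ᵐ x : E3, x ≠ 0 := by simp [ae_iff, measure_singleton]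

theorem aestronglyMeasurable_angular {φ : E3 → ℂ} (hφ : ContDiff ℝ ∞ φ) :
    AEStronglyMeasurable (angular φ) := by
  have h1 : ∀ i, Measurable (pd i φ) := fun i => (contDiff_pd hφ i).continuous.measurable
  have h2 : ∀ i j, Measurable (pd i (pd j φ)) := fun i j =>
    (contDiff_pd (contDiff_pd hφ j) i).continuous.measurable
  have hm : Measurable fun x : E3 => ∑ i, pd i (pd i φ) x
      - (‖x‖ ^ 2)⁻¹ • ∑ i, ∑ j, (x i * x j) • pd i (pd j φ) x
      - (2 * (‖x‖ ^ 2)⁻¹) • ∑ i, x i • pd i φ x := by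
    fun_prop
  refine hm.aestronglyMeasurable.congr ?_
  filter_upwards [ae_ne_zero] with x hx
  exact (angular_eq (contDiff_two hφ) hx).symm

/-- The constant is `54 = 3 (1 + 1 + 4 * 4)`: the Laplacian, the Hessian, and the gradient term
after Hardy's inequality. -/
theorem integral_norm_angular_sq_le {φ : E3 → ℂ} (hφ : IsTest φ) :
    Integrable (fun x => ‖angular φ x‖ ^ 2) ∧
      ∫ x, ‖angular φ x‖ ^ 2 ≤ 54 * ∫ x, ‖lapl φ x‖ ^ 2 := by
  have hL := hφ.laplacian.integrable_norm_sq
  have hH : Integrable fun x => ∑ i, ∑ j, ‖pd i (pd j φ) x‖ ^ 2 :=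
    integrable_finsetSum _ fun i _ => integrable_finsetSum _ fun j _ =>
      ((hφ.pderiv j).pderiv i).integrable_norm_sq
  have hG : Integrable fun x => ∑ i, ‖pd i φ x‖ ^ 2 * (‖x‖ ^ 2)⁻¹ :=
    integrable_finsetSum _ fun i _ => (hardy (hφ.pderiv i)).1
  have hle : (fun x => ‖angular φ x‖ ^ 2) ≤ᵐ[volume] fun x =>
      3 * (‖lapl φ x‖ ^ 2 + ∑ i, ∑ j, ‖pd i (pd j φ) x‖ ^ 2 +
        4 * ∑ i, ‖pd i φ x‖ ^ 2 * (‖x‖ ^ 2)⁻¹) := by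
    filter_upwards [ae_ne_zero] with x hx using norm_angular_sq_le hφ.1 hx
  have hLH : Integrable fun x => ‖lapl φ x‖ ^ 2 + ∑ i, ∑ j, ‖pd i (pd j φ) x‖ ^ 2 := hL.add hH
  have hI := (hLH.add (hG.const_mul 4)).const_mul 3
  have hint : Integrable fun x => ‖angular φ x‖ ^ 2 := by
    refine hI.mono ((aestronglyMeasurable_angular hφ.1).norm.pow 2) ?_
    filter_upwards [hle] with x hx
    rw [Real.norm_of_nonneg (by positivity)]
    exact hx.trans (le_abs_self _)
  refine ⟨hint, (integral_mono_ae hint hI hle).trans ?_⟩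
  -- Hardy's inequality for `∂_i φ` produces `∂_j ∂_i φ`, so the double sum is reordered to put the
  -- inner derivative outermost.
  have hGle : ∫ x, ∑ i, ‖pd i φ x‖ ^ 2 * (‖x‖ ^ 2)⁻¹ ≤ 4 * ∫ x, ‖lapl φ x‖ ^ 2 := by
    rw [integral_finsetSum _ fun i _ => (hardy (hφ.pderiv i)).1, ← integral_hessian hφ,
      integral_congr_ae (Filter.Eventually.of_forall fun x =>
        Finset.sum_comm (f := fun i j => ‖pd i (pd j φ) x‖ ^ 2)),
      integral_finsetSum _ fun i _ => integrable_finsetSum _ fun j _ =>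
      ((hφ.pderiv i).pderiv j).integrable_norm_sq, Finset.mul_sum]
    exact Finset.sum_le_sum fun i _ => (hardy (hφ.pderiv i)).2
  have e : ∫ x, 3 * (‖lapl φ x‖ ^ 2 + ∑ i, ∑ j, ‖pd i (pd j φ) x‖ ^ 2 +
        4 * ∑ i, ‖pd i φ x‖ ^ 2 * (‖x‖ ^ 2)⁻¹) =
      3 * ((∫ x, ‖lapl φ x‖ ^ 2) + (∫ x, ‖lapl φ x‖ ^ 2) +
        4 * ∫ x, ∑ i, ‖pd i φ x‖ ^ 2 * (‖x‖ ^ 2)⁻¹) := by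
    rw [integral_const_mul, integral_add hLH (hG.const_mul 4), integral_add hL hH,
      integral_const_mul, integral_hessian hφ]
  refine (le_of_eq e).trans ?_
  linarith

/-! ### Symmetry -/

/-- The angular momentum `x_i ∂_j - x_j ∂_i`. -/
def rot (i j : Fin 3) (φ : E3 → ℂ) (x : E3) : ℂ := coord i x * pd j φ x - coord j x * pd i φ x

theorem contDiff_rot {φ : E3 → ℂ} (hφ : ContDiff ℝ ∞ φ) (i j : Fin 3) :
    ContDiff ℝ ∞ (rot i j φ) :=
  ((contDiff_coord i).mul (contDiff_pd hφ j)).sub ((contDiff_coord j).mul (contDiff_pd hφ i))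

theorem IsTest.angularMomentum {φ : E3 → ℂ} (hφ : IsTest φ) (i j : Fin 3) : IsTest (rot i j φ) :=
  ((hφ.pderiv j).mul_left (contDiff_coord i)).sub ((hφ.pderiv i).mul_left (contDiff_coord j))

/-- The rotation field is divergence free: for `i ≠ j`, the coefficient `x_i` is not affected by
`∂_j`. -/
theorem IsTest.integral_rot_mul {f g : E3 → ℂ} (hf : IsTest f) (hg : ContDiff ℝ ∞ g)
    (i j : Fin 3) : ∫ x, rot i j f x * g x = -∫ x, f x * rot i j g x := by
  rcases eq_or_ne i j with rfl | hij
  · simp [rot]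
  have hX : ∀ k, ContDiff ℝ ∞ fun x => coord k x * g x := fun k => (contDiff_coord k).mul hg
  have hI : ∀ k l, Integrable fun x => pd k f x * (coord l x * g x) := fun k l =>
    ((hf.pderiv k).mul_right (hX l)).integrable
  have hJ : ∀ k l, Integrable fun x => f x * pd k (fun x => coord l x * g x) x := fun k l =>
    (hf.mul_right (contDiff_pd (hX l) k)).integrable
  have e1 : ∀ x, rot i j f x * g x =
      pd j f x * (coord i x * g x) - pd i f x * (coord j x * g x) := fun x => by
    unfold rot; ring
  have e2 : ∀ x, f x * rot i j g x = f x * pd j (fun x => coord i x * g x) x -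
      f x * pd i (fun x => coord j x * g x) x := fun x => by
    rw [pd_mul (contDiff_coord i) hg, pd_mul (contDiff_coord j) hg, pd_coord, pd_coord,
      if_neg hij, if_neg hij.symm, rot]
    ring
  simp only [e1, e2]
  rw [integral_sub (hI j i) (hI i j), integral_sub (hJ j i) (hJ i j), hf.integral_pd_mul (hX i),
    hf.integral_pd_mul (hX j)]
  ring

theorem IsTest.integral_rot_rot_mul {f g : E3 → ℂ} (hf : IsTest f) (hg : ContDiff ℝ ∞ g)
    (i j : Fin 3) : ∫ x, rot i j (rot i j f) x * g x = ∫ x, f x * rot i j (rot i j g) x := by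
  rw [(hf.angularMomentum i j).integral_rot_mul hg, hf.integral_rot_mul (contDiff_rot hg i j),
    neg_neg]

/-- The operator `Δ_{S²}`, as a sum of squares of angular momenta. -/
def rotSq (φ : E3 → ℂ) (x : E3) : ℂ :=
  rot 0 1 (rot 0 1 φ) x + rot 0 2 (rot 0 2 φ) x + rot 1 2 (rot 1 2 φ) x

theorem pd_rot {φ : E3 → ℂ} (hφ : ContDiff ℝ ∞ φ) (i j k : Fin 3) (x : E3) :
    pd k (rot i j φ) x = coord i x * pd k (pd j φ) x + (if i = k then 1 else 0) * pd j φ x -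
      (coord j x * pd k (pd i φ) x + (if j = k then 1 else 0) * pd i φ x) := by
  have hi := (contDiff_coord i).mul (contDiff_pd hφ j)
  have hj := (contDiff_coord j).mul (contDiff_pd hφ i)
  unfold rot
  rw [pd_sub hi hj, pd_mul (contDiff_coord i) (contDiff_pd hφ j),
    pd_mul (contDiff_coord j) (contDiff_pd hφ i), pd_coord, pd_coord]

/-- Multiplication by `|x|²` clears the denominators of the Cartesian formula; what remains is an
identity between second-order operators with polynomial coefficients. -/
theorem rotSq_eq {φ : E3 → ℂ} (hφ : ContDiff ℝ ∞ φ) {x : E3} (hx : x ≠ 0) :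
    rotSq φ x = ‖x‖ ^ 2 • angular φ x := by
  have hr : (‖x‖ ^ 2) ≠ 0 := by
    have := norm_ne_zero_iff.2 hx
    positivity
  rw [angular_eq (contDiff_two hφ) hx, smul_sub, smul_sub, smul_smul, smul_smul,
    mul_inv_cancel₀ hr, one_smul, mul_left_comm, mul_inv_cancel₀ hr, norm_sq_eq_sum x]
  simp only [rotSq]
  rw [rot, rot, rot]
  simp only [pd_rot hφ, Fin.sum_univ_three, pd_comm hφ 1 0, pd_comm hφ 2 0, pd_comm hφ 2 1,
    Complex.real_smul]
  simp [coord]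
  ring

/-- A rotation field is a derivation that annihilates `|x|²`. -/
theorem rot_normSq_mul {φ : E3 → ℂ} (hφ : ContDiff ℝ ∞ φ) (i j : Fin 3) :
    rot i j (fun x => ((‖x‖ ^ 2 : ℝ) : ℂ) * φ x) =
      fun x => ((‖x‖ ^ 2 : ℝ) : ℂ) * rot i j φ x := by
  funext x
  have hQ : ContDiff ℝ ∞ fun x : E3 => ((‖x‖ ^ 2 : ℝ) : ℂ) :=
    Complex.ofRealCLM.contDiff.comp (contDiff_norm_sq ℝ)
  have hpd : ∀ k, pd k (fun x : E3 => ((‖x‖ ^ 2 : ℝ) : ℂ)) x = 2 * coord k x := fun k => by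
    have : HasFDerivAt (fun x : E3 => ((‖x‖ ^ 2 : ℝ) : ℂ)) _ x :=
      Complex.ofRealCLM.hasFDerivAt.comp x (hasStrictFDerivAt_norm_sq x).hasFDerivAt
    rw [pd, this.fderiv]
    simp [coord, EuclideanSpace.inner_single_right]
  simp only [rot, pd_mul hQ hφ, hpd]
  ring

theorem rotSq_normSq_mul {φ : E3 → ℂ} (hφ : ContDiff ℝ ∞ φ) (x : E3) :
    rotSq (fun x => ((‖x‖ ^ 2 : ℝ) : ℂ) * φ x) x = ((‖x‖ ^ 2 : ℝ) : ℂ) * rotSq φ x := by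
  simp only [rotSq, rot_normSq_mul hφ, rot_normSq_mul (contDiff_rot hφ _ _)]
  ring

theorem IsTest.integral_rotSq_mul {f g : E3 → ℂ} (hf : IsTest f) (hg : ContDiff ℝ ∞ g) :
    ∫ x, rotSq f x * g x = ∫ x, f x * rotSq g x := by
  have hI : ∀ i j, Integrable fun x => rot i j (rot i j f) x * g x := fun i j =>
    (((hf.angularMomentum i j).angularMomentum i j).mul_right hg).integrable
  have hJ : ∀ i j, Integrable fun x => f x * rot i j (rot i j g) x := fun i j =>
    (hf.mul_right (contDiff_rot (contDiff_rot hg i j) i j)).integrable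
  have hI' : Integrable fun x => rot 0 1 (rot 0 1 f) x * g x + rot 0 2 (rot 0 2 f) x * g x :=
    (hI 0 1).add (hI 0 2)
  have hJ' : Integrable fun x => f x * rot 0 1 (rot 0 1 g) x + f x * rot 0 2 (rot 0 2 g) x :=
    (hJ 0 1).add (hJ 0 2)
  simp only [rotSq, add_mul, mul_add]
  rw [integral_add hI' (hI 1 2), integral_add (hI 0 1) (hI 0 2),
    integral_add hJ' (hJ 1 2), integral_add (hJ 0 1) (hJ 0 2)]
  simp only [hf.integral_rot_rot_mul hg]

theorem IsTest.div_normSq {φ : E3 → ℂ} (hφ : IsTest φ) (h0 : (0 : E3) ∉ tsupport φ) :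
    IsTest fun x => (((‖x‖ ^ 2)⁻¹ : ℝ) : ℂ) * φ x := by
  refine ⟨contDiff_iff_contDiffAt.2 fun x => ?_, hφ.2.mul_left⟩
  rcases eq_or_ne x 0 with rfl | hx
  · have h : (fun x => (((‖x‖ ^ 2)⁻¹ : ℝ) : ℂ) * φ x) =ᶠ[nhds 0] fun _ => 0 := by
      filter_upwards [notMem_tsupport_iff_eventuallyEq.1 h0] with y hy
      simp [hy]
    exact contDiffAt_const.congr_of_eventuallyEq h
  · have hr : (‖x‖ ^ 2) ≠ 0 := by
      have := norm_ne_zero_iff.2 hx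
      positivity
    exact (Complex.ofRealCLM.contDiff.contDiffAt.comp x
      ((contDiff_norm_sq ℝ).contDiffAt.inv hr)).mul hφ.1.contDiffAt

/-- `Δ_{S²} / |x|²` is symmetric. -/
theorem IsTest.integral_angular_mul {f φ : E3 → ℂ} (hf : IsTest f) (hφ : IsTest φ)
    (h0 : (0 : E3) ∉ tsupport φ) : ∫ x, angular f x * φ x = ∫ x, f x * angular φ x := by
  -- Dividing by `|x|²` is harmless because `φ` vanishes near the origin. Both integrals then become
  -- pairings with `rotSq`, whose coefficients are smooth at 0 as well.
  set ψ : E3 → ℂ := fun x => (((‖x‖ ^ 2)⁻¹ : ℝ) : ℂ) * φ x with hψdef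
  have hψ : IsTest ψ := hφ.div_normSq h0
  have hr : ∀ x : E3, x ≠ 0 → ((‖x‖ ^ 2 : ℝ) : ℂ) ≠ 0 := fun x hx => by
    have := norm_ne_zero_iff.2 hx
    exact_mod_cast pow_ne_zero 2 this
  have hφψ : φ = fun x => ((‖x‖ ^ 2 : ℝ) : ℂ) * ψ x := by
    funext x
    rcases eq_or_ne x 0 with rfl | hx
    · simpa using image_eq_zero_of_notMem_tsupport h0
    · have := hr x hx
      simp only [hψdef]
      rw [← mul_assoc, Complex.ofReal_inv, mul_inv_cancel₀ this, one_mul]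
  have e1 : ∫ x, angular f x * φ x = ∫ x, rotSq f x * ψ x := by
    refine integral_congr_ae ?_
    filter_upwards [ae_ne_zero] with x hx
    rw [rotSq_eq hf.1 hx, hφψ, Complex.real_smul]
    ring
  have e2 : ∫ x, f x * angular φ x = ∫ x, f x * rotSq ψ x := by
    refine integral_congr_ae ?_
    filter_upwards [ae_ne_zero] with x hx
    have h1 := rotSq_eq hφ.1 hx
    have h2 := rotSq_normSq_mul hψ.1 x
    rw [← hφψ, h1, Complex.real_smul] at h2
    rw [mul_left_cancel₀ (hr x hx) h2]
  rw [e1, e2, hf.integral_rotSq_mul hψ.1]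

end SphericalHardy

namespace SphericalHardy

open FourierTransform
open scoped BoundedContinuousFunction Real

/-! ### Schwartz functions are dense in `H²` -/

/-- Plancherel: a bounded symbol acts on the Fourier side as multiplication by an `L^∞` function. -/
theorem exists_norm_le_of_eq_fourierMultiplier {g : E3 → ℂ} (hg : g.HasTemperateGrowth) {C : ℝ}
    (hC : ∀ x, ‖g x‖ ≤ C) : ∃ K, ∀ u v : L2,
      (v : 𝓢'(E3, ℂ)) = fourierMultiplierCLM ℂ g (u : 𝓢'(E3, ℂ)) → ‖v‖ ≤ K * ‖u‖ := by
  let g' : E3 →ᵇ ℂ := BoundedContinuousFunction.ofNormedAddCommGroup g hg.1.continuous C hC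
  have hg' : MemLp g ∞ (volume : Measure E3) := g'.memLp_top
  refine ⟨‖hg'.toLp _‖, fun u v h => ?_⟩
  have hv : v = 𝓕⁻ (hg'.toLp _ • 𝓕 u : L2) := by
    apply toTemperedDistribution_injective
    simp only [Lp.toTemperedDistributionCLM_apply]
    rw [h, ← Lp.fourierInv_toTemperedDistribution_eq, Lp.toTemperedDistribution_smul_eq hg,
      ← Lp.fourier_toTemperedDistribution_eq, TemperedDistribution.fourierMultiplierCLM_apply]
  rw [hv, ← Lp.norm_fourier_eq, fourier_fourierInv_eq, ← Lp.norm_fourier_eq u]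
  exact Lp.norm_smul_le _ _

namespace H2

theorem toL2_injective : Function.Injective toL2 := Subtype.val_injective

theorem lap_spec (f : H2) : Δ ((f.toL2 : L2) : 𝓢'(E3, ℂ)) = ((lap f : L2) : 𝓢'(E3, ℂ)) :=
  weakLaplacian_spec f

theorem lap_eq {f : H2} {g : L2} (h : Δ ((f.toL2 : L2) : 𝓢'(E3, ℂ)) = (g : 𝓢'(E3, ℂ))) :
    lap f = g := by
  apply toTemperedDistribution_injective
  simp only [Lp.toTemperedDistributionCLM_apply]
  rw [← lap_spec, h]

theorem norm_sq_eq (f : H2) : ‖f‖ ^ 2 = ‖lap f‖ ^ 2 + ‖toL2 f‖ ^ 2 := by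
  rw [norm_eq, Real.sq_sqrt (by positivity), norm_neg]

theorem norm_le (f : H2) : ‖f‖ ≤ ‖lap f‖ + ‖toL2 f‖ := by
  refine le_of_sq_le_sq ?_ (by positivity)
  rw [norm_sq_eq]
  nlinarith [norm_nonneg (lap f), norm_nonneg (toL2 f)]

theorem norm_lap_le (f : H2) : ‖lap f‖ ≤ ‖f‖ := by
  refine le_of_sq_le_sq ?_ (norm_nonneg _)
  rw [norm_sq_eq]
  nlinarith [sq_nonneg ‖toL2 f‖]

theorem norm_toL2_le (f : H2) : ‖toL2 f‖ ≤ ‖f‖ := by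
  refine le_of_sq_le_sq ?_ (norm_nonneg _)
  rw [norm_sq_eq]
  nlinarith [sq_nonneg ‖lap f‖]

theorem toLp_mem_sobolevH2 (f : 𝓢(E3, ℂ)) :
    SchwartzMap.toLpCLM ℂ ℂ 2 (volume : Measure E3) f ∈ sobolevH2 := by
  have h : MemSobolev 2 2 ((f.toLp 2 : L2) : 𝓢'(E3, ℂ)) := by
    rw [Lp.toTemperedDistribution_toLp_eq]
    exact f.memSobolev
  exact h

/-- Schwartz functions as elements of `H²`. -/
def ofSchwartz : 𝓢(E3, ℂ) →ₗ[ℂ] H2 :=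
  (SchwartzMap.toLpCLM ℂ ℂ 2 (volume : Measure E3)).toLinearMap.codRestrict sobolevH2
    toLp_mem_sobolevH2

theorem toL2_ofSchwartz (f : 𝓢(E3, ℂ)) : toL2 (ofSchwartz f) = f.toLp 2 := rfl

theorem lap_ofSchwartz (f : 𝓢(E3, ℂ)) : lap (ofSchwartz f) = (Δ f).toLp 2 := by
  apply lap_eq
  rw [toL2_ofSchwartz, Lp.toTemperedDistribution_toLp_eq (Δ f), Lp.toTemperedDistribution_toLp_eq f]
  exact TemperedDistribution.laplacian_toTemperedDistributionCLM_eq f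

/-- On the Fourier side `u` and `Δu` arise from `h` by the symbols `(1 + |ξ|²)⁻¹` and `-(2π)² |ξ|²
(1 + |ξ|²)⁻¹`; both are bounded. -/
theorem exists_norm_le_of_besselPotential : ∃ K, ∀ (u : H2) (h : L2),
    besselPotential E3 ℂ 2 (u.toL2 : 𝓢'(E3, ℂ)) = (h : 𝓢'(E3, ℂ)) → ‖u‖ ≤ K * ‖h‖ := by
  have hg1 : (fun x : E3 => (((1 + ‖x‖ ^ 2) ^ ((-2 : ℝ) / 2) : ℝ) : ℂ)).HasTemperateGrowth := by
    fun_prop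
  have hg2 : (fun x : E3 => ((‖x‖ ^ 2 : ℝ) : ℂ)).HasTemperateGrowth := by fun_prop
  have hinv : ∀ x : E3, ((1 + ‖x‖ ^ 2) ^ ((-2 : ℝ) / 2) : ℝ) = (1 + ‖x‖ ^ 2)⁻¹ := fun x => by
    norm_num [Real.rpow_neg_one]
  obtain ⟨K1, h1⟩ := exists_norm_le_of_eq_fourierMultiplier hg1 (C := 1) fun x => by
    rw [hinv, Complex.norm_real, Real.norm_of_nonneg (by positivity)]
    exact inv_le_one_of_one_le₀ (by nlinarith [sq_nonneg ‖x‖])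
  obtain ⟨K2, h2⟩ := exists_norm_le_of_eq_fourierMultiplier (hg1.mul hg2) (C := 1) fun x => by
    rw [Pi.mul_apply, hinv, norm_mul, Complex.norm_real, Complex.norm_real,
      Real.norm_of_nonneg (by positivity), Real.norm_of_nonneg (by positivity),
      inv_mul_le_iff₀ (by positivity)]
    linarith
  refine ⟨(2 * π) ^ 2 * K2 + K1, fun u h hu => ?_⟩
  have hu' : (u.toL2 : 𝓢'(E3, ℂ)) = besselPotential E3 ℂ (-2) (h : 𝓢'(E3, ℂ)) :=
    ((besselPotential_neg_apply_eq_iff 2 _ _).2 hu).symm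
  have e1 := h1 h u.toL2 hu'
  have hw : ((-(((2 * π) ^ 2 : ℝ) : ℂ)⁻¹ • lap u : L2) : 𝓢'(E3, ℂ)) = fourierMultiplierCLM ℂ
      ((fun x : E3 => (((1 + ‖x‖ ^ 2) ^ ((-2 : ℝ) / 2) : ℝ) : ℂ)) *
        fun x : E3 => ((‖x‖ ^ 2 : ℝ) : ℂ)) (h : 𝓢'(E3, ℂ)) := by
    rw [← Lp.toTemperedDistributionCLM_apply, map_smul, Lp.toTemperedDistributionCLM_apply,
      ← lap_spec, hu', TemperedDistribution.laplacian_eq_fourierMultiplierCLM, besselPotential,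
      TemperedDistribution.fourierMultiplierCLM_fourierMultiplierCLM_apply hg1 hg2,
      ← Complex.coe_smul, smul_smul]
    push_cast
    rw [neg_mul_neg, inv_mul_cancel₀ (by simp), one_smul]
  have e2 := h2 h _ hw
  rw [norm_smul, norm_neg, norm_inv, Complex.norm_real, Real.norm_of_nonneg (by positivity),
    inv_mul_le_iff₀ (by positivity)] at e2
  calc ‖u‖ ≤ ‖lap u‖ + ‖toL2 u‖ := norm_le u
    _ ≤ _ := by linarith

theorem coe_sub (u v : L2) : ((u - v : L2) : 𝓢'(E3, ℂ)) = (u : 𝓢'(E3, ℂ)) - (v : 𝓢'(E3, ℂ)) :=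
  map_sub (Lp.toTemperedDistributionCLM ℂ (volume : Measure E3) 2) u v

theorem exists_besselPotential_ofSchwartz (s : 𝓢(E3, ℂ)) : ∃ t : 𝓢(E3, ℂ),
    besselPotential E3 ℂ 2 ((ofSchwartz t).toL2 : 𝓢'(E3, ℂ)) =
      ((s.toLp 2 : L2) : 𝓢'(E3, ℂ)) := by
  refine ⟨SchwartzMap.fourierMultiplierCLM ℂ
    (fun x : E3 => (((1 + ‖x‖ ^ 2) ^ ((-2 : ℝ) / 2) : ℝ) : ℂ)) s, ?_⟩
  rw [← besselPotential_neg_apply_eq_iff, toL2_ofSchwartz, Lp.toTemperedDistribution_toLp_eq,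
    Lp.toTemperedDistribution_toLp_eq, besselPotential,
    TemperedDistribution.fourierMultiplierCLM_toTemperedDistributionCLM_eq (by fun_prop)]

/-- The Bessel potential of `f` is approximated in `L²` by Schwartz functions, whose inverse Bessel
potentials are again Schwartz and approximate `f` in `H²`. -/
theorem denseRange_ofSchwartz : DenseRange ofSchwartz := by
  obtain ⟨K, hK⟩ := exists_norm_le_of_besselPotential
  refine Metric.denseRange_iff.2 fun f δ hδ => ?_
  obtain ⟨h, hh⟩ : MemSobolev 2 2 (f.toL2 : 𝓢'(E3, ℂ)) := f.2
  have hK' : 0 < |K| + 1 := by positivity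
  have hdense : DenseRange (SchwartzMap.toLpCLM ℝ ℂ 2 (volume : Measure E3)) :=
    SchwartzMap.denseRange_toLpCLM ENNReal.ofNat_ne_top
  obtain ⟨s, hs⟩ := Metric.denseRange_iff.1 hdense h _ (div_pos hδ hK')
  obtain ⟨t, ht⟩ := exists_besselPotential_ofSchwartz s
  refine ⟨t, ?_⟩
  set z : L2 := s.toLp 2
  replace hs : dist h z < δ / (|K| + 1) := hs
  have hd : besselPotential E3 ℂ 2 ((f - ofSchwartz t).toL2 : 𝓢'(E3, ℂ)) =
      ((h - z : L2) : 𝓢'(E3, ℂ)) := by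
    rw [map_sub, coe_sub, map_sub, hh, ht, ← coe_sub]
  rw [dist_eq_norm] at hs ⊢
  calc ‖f - ofSchwartz t‖ ≤ K * ‖h - z‖ := hK _ _ hd
    _ ≤ (|K| + 1) * ‖h - z‖ := by
        gcongr
        linarith [le_abs_self K]
    _ < (|K| + 1) * (δ / (|K| + 1)) := by gcongr
    _ = δ := by field_simp

end H2

end SphericalHardy

namespace SphericalHardy

open scoped LineDeriv

/-! ### Test functions are dense in `H²` -/

theorem laplacian_schwartz_apply (f : 𝓢(E3, ℂ)) (x : E3) : (Δ f : 𝓢(E3, ℂ)) x = lapl f x := by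
  rw [SchwartzMap.laplacian_eq_sum (EuclideanSpace.basisFun (Fin 3) ℝ)]
  simp [lapl, SchwartzMap.lineDerivOp_apply_eq_fderiv, pd]
  rfl

theorem IsTest.exists_bound {φ : E3 → ℂ} (hφ : IsTest φ) : ∃ C, 0 ≤ C ∧ ∀ x, ‖φ x‖ ≤ C := by
  obtain ⟨C, hC⟩ := hφ.2.exists_bound_of_continuous hφ.1.continuous
  exact ⟨C, (norm_nonneg _).trans (hC 0), hC⟩

/-- The linear bound, applied at `ε • x`, gives the rate `ε ‖x‖`; a Schwartz function absorbs the
weight `‖x‖`. -/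
theorem exists_cutoff : ∃ χ : E3 → ℂ, IsTest χ ∧ ∀ y, ‖1 - χ y‖ ≤ ‖y‖ := by
  let b : ContDiffBump (0 : E3) := ⟨1, 2, one_pos, one_lt_two⟩
  refine ⟨fun x => ((b x : ℝ) : ℂ), ⟨Complex.ofRealCLM.contDiff.comp b.contDiff,
    b.hasCompactSupport.comp_left (g := fun r : ℝ => (r : ℂ)) Complex.ofReal_zero⟩, fun y => ?_⟩
  dsimp only
  rcases le_total ‖y‖ 1 with hy | hy
  · rw [b.one_of_mem_closedBall (by simpa using hy)]
    simp
  · rw [← Complex.ofReal_one, ← Complex.ofReal_sub, Complex.norm_real,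
      Real.norm_of_nonneg (sub_nonneg.2 b.le_one)]
    linarith [b.nonneg (x := y)]

theorem pd_comp_smul {χ : E3 → ℂ} (hχ : ContDiff ℝ ∞ χ) (ε : ℝ) (i : Fin 3) :
    pd i (fun x => χ (ε • x)) = fun x => (ε : ℂ) * pd i χ (ε • x) := by
  funext x
  have h1 : HasFDerivAt (fun x : E3 => ε • x) (ε • ContinuousLinearMap.id ℝ E3) x :=
    (hasFDerivAt_id x).const_smul ε
  have h2 : HasFDerivAt (fun x => χ (ε • x)) _ x :=
    (differentiable_of_contDiff hχ (ε • x)).hasFDerivAt.comp x h1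
  rw [pd, h2.fderiv]
  simp [pd]

theorem contDiff_comp_smul {χ : E3 → ℂ} (hχ : ContDiff ℝ ∞ χ) (ε : ℝ) :
    ContDiff ℝ ∞ fun x => χ (ε • x) := hχ.comp (contDiff_const_smul ε)

theorem lapl_one_sub_cutoff_mul {χ f : E3 → ℂ} (hχ : ContDiff ℝ ∞ χ) (hf : ContDiff ℝ ∞ f) (ε : ℝ)
    (x : E3) : lapl (fun x => f x - χ (ε • x) * f x) x =
      (1 - χ (ε • x)) * lapl f x - 2 * ε * ∑ i, pd i χ (ε • x) * pd i f x -
        ε ^ 2 * lapl χ (ε • x) * f x := by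
  have hχε := contDiff_comp_smul hχ ε
  have h2 : ∀ i, pd i (fun x => f x - χ (ε • x) * f x) = fun x =>
      pd i f x - (χ (ε • x) * pd i f x + (ε : ℂ) * (pd i χ (ε • x) * f x)) := fun i => by
    funext x
    rw [pd_sub hf (hχε.mul hf), pd_mul hχε hf, pd_comp_smul hχ]
    ring
  have h3 : ∀ i, pd i (pd i (fun x => f x - χ (ε • x) * f x)) x =
      (1 - χ (ε • x)) * pd i (pd i f) x - 2 * ε * (pd i χ (ε • x) * pd i f x) -
        ε ^ 2 * pd i (pd i χ) (ε • x) * f x := fun i => by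
    have hχi := contDiff_comp_smul (contDiff_pd hχ i) ε
    have ha := hχε.mul (contDiff_pd hf i)
    have hb := hχi.mul hf
    have hc : ContDiff ℝ ∞ fun x => (ε : ℂ) * (pd i χ (ε • x) * f x) := contDiff_const.mul hb
    have hadd : pd i (fun x => χ (ε • x) * pd i f x + (ε : ℂ) * (pd i χ (ε • x) * f x)) x =
        pd i (fun x => χ (ε • x) * pd i f x) x +
          pd i (fun x => (ε : ℂ) * (pd i χ (ε • x) * f x)) x := by
      unfold pd at ha hc ⊢
      rw [fderiv_fun_add (differentiable_of_contDiff ha x) (differentiable_of_contDiff hc x)]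
      rfl
    rw [h2, pd_sub (contDiff_pd hf i) (ha.add hc), hadd, pd_mul hχε (contDiff_pd hf i),
      pd_mul contDiff_const hb, pd_mul hχi hf, pd_comp_smul hχ, pd_comp_smul (contDiff_pd hχ i)]
    simp [show pd i (fun _ : E3 => (ε : ℂ)) x = 0 by simp [pd]]
    ring
  simp only [lapl, h3, Finset.sum_sub_distrib, ← Finset.mul_sum, ← Finset.sum_mul]

theorem memLp_norm_mul_schwartz (u : 𝓢(E3, ℂ)) :
    MemLp (fun x => ‖x‖ * ‖u x‖) 2 (volume : Measure E3) := by
  have hm : Continuous fun x : E3 => ‖x‖ * ‖u x‖ := continuous_norm.mul u.continuous.norm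
  obtain ⟨C, -, hC⟩ := u.decay 0 0
  rw [memLp_two_iff_integrable_sq hm.aestronglyMeasurable]
  refine ((u.integrable_pow_mul volume 2).mul_bdd (c := C) u.continuous.norm.aestronglyMeasurable
    (Filter.Eventually.of_forall fun x => ?_)).congr (Filter.Eventually.of_forall fun x => ?_)
  · simpa using hC x
  · simp only; ring

theorem norm_le_of_pointwise_le {u : L2} {g : E3 → ℝ} (hg : MemLp g 2 (volume : Measure E3)) {ε : ℝ}
    (h : ∀ᵐ x, ‖u x‖ ≤ ε * g x) (hε : 0 ≤ ε) : ‖u‖ ≤ ε * ‖hg.toLp g‖ := by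
  refine Lp.norm_le_mul_norm_of_ae_le_mul ?_
  filter_upwards [h, hg.coeFn_toLp] with x hx hgx
  rw [hgx]
  exact hx.trans (by gcongr; exact le_abs_self _)

/-- A test function as a Schwartz function. -/
def IsTest.toSchwartz {φ : E3 → ℂ} (hφ : IsTest φ) : 𝓢(E3, ℂ) :=
  hφ.hasCompactSupport.toSchwartzMap hφ.contDiff

theorem IsTest.toSchwartz_apply {φ : E3 → ℂ} (hφ : IsTest φ) (x : E3) : hφ.toSchwartz x = φ x := rfl

theorem IsTest.cutoff_mul {χ : E3 → ℂ} (hχ : IsTest χ) (f : 𝓢(E3, ℂ)) {ε : ℝ} (hε : ε ≠ 0) :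
    IsTest fun x => χ (ε • x) * f x :=
  IsTest.mul_right ⟨contDiff_comp_smul hχ.1 ε, hχ.2.comp_smul hε⟩ (f.smooth ⊤)

/-- Cutting off at scale `1/ε` makes an error of order `ε` in `f` and in `Δf`: either `1 - χ(ε x)`
contributes `ε ‖x‖`, or a derivative falls on the cutoff. -/
theorem exists_test_near_schwartz (f : 𝓢(E3, ℂ)) {δ : ℝ} (hδ : 0 < δ) :
    ∃ (φ : E3 → ℂ) (hφ : IsTest φ), ‖H2.ofSchwartz f - H2.ofSchwartz hφ.toSchwartz‖ < δ := by
  obtain ⟨χ, hχ, hχ1⟩ := exists_cutoff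
  have hf : ContDiff ℝ ∞ f := f.smooth ⊤
  choose C hC0 hC using fun i => (hχ.pderiv i).exists_bound
  obtain ⟨D, hD0, hD⟩ := hχ.laplacian.exists_bound
  have hM1 := memLp_norm_mul_schwartz f
  -- An `L²` majorant, up to the factor `ε`, of the three terms of the Leibniz rule for the
  -- Laplacian.
  have hM2 : MemLp (fun x => ‖x‖ * ‖(Δ f : 𝓢(E3, ℂ)) x‖ +
      ∑ i, 2 * C i * ‖(∂_{(EuclideanSpace.single i 1 : E3)} f : 𝓢(E3, ℂ)) x‖ + D * ‖f x‖) 2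
      (volume : Measure E3) := by
    refine ((memLp_norm_mul_schwartz (Δ f)).add (memLp_finsetSum _ fun i _ => ?_)).add ?_
    · exact ((SchwartzMap.memLp _ 2 volume).norm).const_mul _
    · exact ((f.memLp 2 volume).norm).const_mul _
  set K := ‖hM2.toLp _‖ + ‖hM1.toLp _‖ with hK
  have hK0 : 0 ≤ K := by positivity
  obtain ⟨ε, hε0, hε1, hεδ⟩ : ∃ ε : ℝ, 0 < ε ∧ ε ≤ 1 ∧ ε * K < δ := by
    refine ⟨min 1 (δ / (K + 1)), by positivity, min_le_left _ _, ?_⟩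
    calc min 1 (δ / (K + 1)) * K ≤ δ / (K + 1) * K := by gcongr; exact min_le_right _ _
      _ < δ / (K + 1) * (K + 1) := by gcongr; linarith
      _ = δ := by field_simp
  have hφ := hχ.cutoff_mul f hε0.ne'
  refine ⟨_, hφ, ?_⟩
  rw [← map_sub]
  have hcut : ∀ x : E3, ‖1 - χ (ε • x)‖ ≤ ε * ‖x‖ := fun x => by
    simpa [norm_smul, abs_of_pos hε0] using hχ1 (ε • x)
  have b1 : ‖H2.toL2 (H2.ofSchwartz (f - hφ.toSchwartz))‖ ≤ ε * ‖hM1.toLp _‖ := by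
    refine norm_le_of_pointwise_le hM1 ?_ hε0.le
    rw [H2.toL2_ofSchwartz]
    filter_upwards [(f - hφ.toSchwartz).coeFn_toLp 2 volume] with x hx
    rw [hx, _root_.sub_apply, hφ.toSchwartz_apply,
      show f x - χ (ε • x) * f x = (1 - χ (ε • x)) * f x by ring, norm_mul, ← mul_assoc]
    gcongr
    exact hcut x
  have b2 : ‖H2.lap (H2.ofSchwartz (f - hφ.toSchwartz))‖ ≤ ε * ‖hM2.toLp _‖ := by
    refine norm_le_of_pointwise_le hM2 ?_ hε0.le
    rw [H2.lap_ofSchwartz]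
    filter_upwards [(Δ (f - hφ.toSchwartz)).coeFn_toLp 2 volume] with x hx
    rw [hx, laplacian_schwartz_apply, laplacian_schwartz_apply,
      show (⇑(f - hφ.toSchwartz) : E3 → ℂ) = fun x => f x - χ (ε • x) * f x from rfl,
      lapl_one_sub_cutoff_mul hχ.1 hf]
    refine (norm_sub_le _ _).trans ((add_le_add_left (norm_sub_le _ _) _).trans ?_)
    rw [mul_add, mul_add]
    refine add_le_add (add_le_add ?_ ?_) ?_
    · rw [norm_mul, ← mul_assoc]
      gcongr
      exact hcut x
    · rw [norm_mul, norm_mul, Complex.norm_real, Real.norm_of_nonneg hε0.le, Complex.norm_ofNat,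
        mul_comm 2 ε, mul_assoc]
      gcongr
      rw [← le_div_iff₀' two_pos, Finset.sum_div]
      refine (norm_sum_le _ _).trans (Finset.sum_le_sum fun i _ => ?_)
      rw [norm_mul, mul_assoc, mul_div_cancel_left₀ _ two_ne_zero]
      exact mul_le_mul (hC i _) le_rfl (norm_nonneg _) (hC0 i)
    · rw [norm_mul, norm_mul, norm_pow, Complex.norm_real, Real.norm_of_nonneg hε0.le, mul_assoc]
      have : ε ^ 2 ≤ ε := by nlinarith
      gcongr
      exact hD _
  calc _ ≤ _ := H2.norm_le _
    _ ≤ ε * ‖hM2.toLp _‖ + ε * ‖hM1.toLp _‖ := add_le_add b2 b1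
    _ = ε * K := by rw [hK]; ring
    _ < δ := hεδ

/-- The space `C_c^∞(ℝ³)`. -/
def testSpace : Submodule ℂ (E3 → ℂ) where
  carrier := {φ | IsTest φ}
  add_mem' hf hg := ⟨hf.1.add hg.1, hf.2.add hg.2⟩
  zero_mem' := ⟨contDiff_const, HasCompactSupport.zero⟩
  smul_mem' c _ hf := ⟨contDiff_const.smul hf.1, hf.2.smul_left (f := fun _ => c)⟩

/-- Test functions as elements of `H²`. -/
def testToH2 : testSpace →ₗ[ℂ] H2 :=
  H2.ofSchwartz ∘ₗ
    { toFun := fun φ => φ.2.toSchwartz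
      map_add' := fun _ _ => rfl
      map_smul' := fun _ _ => rfl }

theorem testToH2_apply (φ : testSpace) : testToH2 φ = H2.ofSchwartz φ.2.toSchwartz := rfl

theorem denseRange_testToH2 : DenseRange testToH2 := by
  refine Metric.denseRange_iff.2 fun f δ hδ => ?_
  obtain ⟨s, hs⟩ := Metric.denseRange_iff.1 H2.denseRange_ofSchwartz f _ (half_pos hδ)
  obtain ⟨φ, hφ, hd⟩ := exists_test_near_schwartz s (half_pos hδ)
  refine ⟨⟨φ, hφ⟩, ?_⟩
  rw [← dist_eq_norm] at hd
  calc dist f (H2.ofSchwartz hφ.toSchwartz) ≤ _ := dist_triangle _ _ _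
    _ < δ / 2 + δ / 2 := add_lt_add hs hd
    _ = δ := add_halves δ

end SphericalHardy

namespace SphericalHardy

open ComplexConjugate

/-! ### The bounded extension -/

theorem norm_sq_eq_integral (f : L2) : ‖f‖ ^ 2 = ∫ x, ‖f x‖ ^ 2 := by
  apply Complex.ofReal_injective
  rw [Complex.ofReal_pow, ← RCLike.ofReal_eq_complex_ofReal, ← inner_self_eq_norm_sq_to_K (𝕜 := ℂ),
    L2.inner_def]
  refine Eq.trans ?_ integral_complex_ofReal
  simp

theorem IsTest.memLp_angular {φ : E3 → ℂ} (hφ : IsTest φ) : MemLp (angular φ) 2 :=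
  (memLp_two_iff_integrable_sq_norm (aestronglyMeasurable_angular hφ.1)).2
    (integral_norm_angular_sq_le hφ).1

theorem pd_add {f g : E3 → ℂ} (hf : ContDiff ℝ ∞ f) (hg : ContDiff ℝ ∞ g) (i : Fin 3) :
    pd i (f + g) = pd i f + pd i g := by
  funext x
  unfold pd
  rw [fderiv_add (differentiable_of_contDiff hf x) (differentiable_of_contDiff hg x)]
  rfl

theorem pd_const_smul {f : E3 → ℂ} (hf : ContDiff ℝ ∞ f) (c : ℂ) (i : Fin 3) :
    pd i (c • f) = c • pd i f := by
  funext x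
  unfold pd
  rw [fderiv_const_smul (differentiable_of_contDiff hf x)]
  rfl

theorem angular_add {f g : E3 → ℂ} (hf : ContDiff ℝ ∞ f) (hg : ContDiff ℝ ∞ g) :
    angular (f + g) = angular f + angular g := by
  funext x
  rcases eq_or_ne x 0 with rfl | hx
  · simp [angular]
  have hfg : ContDiff ℝ ∞ (f + g) := hf.add hg
  rw [Pi.add_apply, angular_eq (contDiff_two hf) hx, angular_eq (contDiff_two hg) hx,
    angular_eq (contDiff_two hfg) hx]
  simp only [pd_add hf hg, pd_add (contDiff_pd hf _) (contDiff_pd hg _), Pi.add_apply, smul_add,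
    Finset.sum_add_distrib]
  ring

theorem angular_const_smul {f : E3 → ℂ} (hf : ContDiff ℝ ∞ f) (c : ℂ) :
    angular (c • f) = c • angular f := by
  funext x
  rcases eq_or_ne x 0 with rfl | hx
  · simp [angular]
  have hcf : ContDiff ℝ ∞ (c • f) := hf.const_smul c
  rw [Pi.smul_apply, angular_eq (contDiff_two hf) hx,
    angular_eq (contDiff_two hcf) hx]
  simp only [pd_const_smul hf, pd_const_smul (contDiff_pd hf _), Pi.smul_apply, smul_sub,
    Finset.smul_sum, smul_comm c]

/-- `Δ_{S²} / |x|²` on test functions, with values in `L²`. -/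
def angularTest : testSpace →ₗ[ℂ] L2 where
  toFun φ := φ.2.memLp_angular.toLp (angular φ)
  map_add' φ ψ := by
    rw [← MemLp.toLp_add]
    exact MemLp.toLp_congr _ _ (Filter.EventuallyEq.of_eq (angular_add φ.2.1 ψ.2.1))
  map_smul' c φ := by
    rw [RingHom.id_apply, ← MemLp.toLp_const_smul]
    exact MemLp.toLp_congr _ _ (Filter.EventuallyEq.of_eq (angular_const_smul φ.2.1 c))

theorem coeFn_angularTest (φ : testSpace) : (angularTest φ : E3 → ℂ) =ᵐ[volume] angular φ :=
  φ.2.memLp_angular.coeFn_toLp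

theorem coeFn_testToH2 (φ : testSpace) : (H2.toL2 (testToH2 φ) : E3 → ℂ) =ᵐ[volume] φ := by
  rw [testToH2_apply, H2.toL2_ofSchwartz]
  exact SchwartzMap.coeFn_toLp _ 2 volume

theorem norm_angularTest_le (φ : testSpace) : ‖angularTest φ‖ ≤ 22 * ‖testToH2 φ‖ := by
  have h1 : ‖angularTest φ‖ ^ 2 = ∫ x, ‖angular φ x‖ ^ 2 := by
    rw [norm_sq_eq_integral]
    refine integral_congr_ae ?_
    filter_upwards [coeFn_angularTest φ] with x hx
    rw [hx]
  have h2 : ‖H2.lap (testToH2 φ)‖ ^ 2 = ∫ x, ‖lapl φ x‖ ^ 2 := by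
    rw [norm_sq_eq_integral, testToH2_apply, H2.lap_ofSchwartz]
    refine integral_congr_ae ?_
    filter_upwards [(Δ φ.2.toSchwartz).coeFn_toLp 2 volume] with x hx
    rw [hx, laplacian_schwartz_apply]
    rfl
  have h3 := (integral_norm_angular_sq_le φ.2).2
  rw [← h1, ← h2] at h3
  have h4 := H2.norm_lap_le (testToH2 φ)
  refine le_trans (le_of_sq_le_sq ?_ (by positivity)) (mul_le_mul_of_nonneg_left h4 (by norm_num))
  rw [mul_pow]
  -- Here `54 ≤ 22² = 484`.
  nlinarith [sq_nonneg ‖H2.lap (testToH2 φ)‖]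

/-- The operator `Δ_{S²} / |x|² : H² → L²`. -/
def angularCLM : H2 →L[ℂ] L2 := angularTest.extendOfNorm testToH2

theorem angularCLM_testToH2 (φ : testSpace) : angularCLM (testToH2 φ) = angularTest φ :=
  LinearMap.extendOfNorm_eq denseRange_testToH2 ⟨22, norm_angularTest_le⟩ φ

theorem extendsAngular_angularCLM : ExtendsAngular angularCLM := fun φ h1 h2 =>
  ⟨testToH2 ⟨φ, h1, h2⟩, coeFn_testToH2 _, by
    rw [angularCLM_testToH2]; exact coeFn_angularTest _⟩

/-- The element of `H²` that represents a test function is determined by its `L²` class, so `T` is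
prescribed on a dense subspace. -/
theorem ExtendsAngular.eq_angularCLM {T : H2 →L[ℂ] L2} (hT : ExtendsAngular T) :
    T = angularCLM := by
  refine (LinearMap.extendOfNorm_unique denseRange_testToH2 22 norm_angularTest_le T ?_).symm
  ext1 φ
  obtain ⟨f, hf, hTf⟩ := hT φ φ.2.1 φ.2.2
  have hfe : f = testToH2 φ :=
    H2.toL2_injective (Lp.ext (hf.trans (coeFn_testToH2 φ).symm))
  rw [hfe] at hTf
  exact Lp.ext (hTf.trans (coeFn_angularTest φ).symm)

theorem norm_angularCLM_le : ‖angularCLM‖ ≤ 22 :=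
  LinearMap.opNorm_extendOfNorm_le denseRange_testToH2 (by norm_num) norm_angularTest_le

/-! ### The weak formulation -/

/-- The pairing is bilinear, hence the inner product with the conjugate of `φ`. -/
theorem continuous_integral_mul {φ : E3 → ℂ} (hφ : MemLp φ 2) :
    Continuous fun f : L2 => ∫ x, f x * φ x := by
  have h : (fun f : L2 => ∫ x, f x * φ x) = fun f => inner ℂ (hφ.star.toLp (star φ)) f := by
    funext f
    rw [L2.inner_def]
    refine integral_congr_ae ?_
    filter_upwards [hφ.star.coeFn_toLp] with x hx
    simp [hx]
  rw [h]
  fun_prop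

theorem IsTest.memLp {φ : E3 → ℂ} (hφ : IsTest φ) : MemLp φ 2 :=
  hφ.1.continuous.memLp_of_hasCompactSupport hφ.2

/-- For fixed `φ`, both sides are continuous in `f` for the `H²` norm, so it suffices to take `f` a
test function, where symmetry applies. -/
theorem isWeakAngular_angularCLM (f : H2) : IsWeakAngular f.toL2 (angularCLM f) := by
  intro φ h1 h2 h0
  have hφ : IsTest φ := ⟨h1, h2⟩
  have hL : Continuous H2.toL2 :=
    (H2.toL2.mkContinuous 1 fun f => by simpa using H2.norm_toL2_le f).continuous
  refine denseRange_testToH2.induction_on f ?_ fun ψ => ?_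
  · exact isClosed_eq ((continuous_integral_mul hφ.memLp).comp angularCLM.continuous)
      ((continuous_integral_mul hφ.memLp_angular).comp hL)
  · rw [angularCLM_testToH2]
    have e1 : ∫ x, angularTest ψ x * φ x = ∫ x, angular ψ x * φ x := by
      refine integral_congr_ae ?_
      filter_upwards [coeFn_angularTest ψ] with x hx
      rw [hx]
    have e2 : ∫ x, H2.toL2 (testToH2 ψ) x * angular φ x = ∫ x, ψ.1 x * angular φ x := by
      refine integral_congr_ae ?_
      filter_upwards [coeFn_testToH2 ψ] with x hx
      rw [hx]
    rw [e1, e2, ψ.2.integral_angular_mul hφ h0]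

/-- The fundamental lemma of the calculus of variations on `ℝ³ \ {0}`, tested with real functions;
the origin is a null set. -/
theorem IsWeakAngular.unique {f g g' : L2} (hg : IsWeakAngular f g) (hg' : IsWeakAngular f g') :
    g = g' := by
  have hloc : LocallyIntegrable (fun x => g x - g' x) :=
    ((Lp.memLp g).locallyIntegrable one_le_two).sub ((Lp.memLp g').locallyIntegrable one_le_two)
  have h : ∀ᵐ x : E3, x ∈ ({0}ᶜ : Set E3) → g x - g' x = 0 := by
    refine isOpen_compl_singleton.ae_eq_zero_of_integral_contDiff_smul_eq_zero
      (hloc.locallyIntegrableOn _) fun η h1 h2 h3 => ?_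
    have hs : tsupport (fun x => ((η x : ℝ) : ℂ)) ⊆ tsupport η :=
      closure_mono fun x hx => by simpa using hx
    have hφ : IsTest fun x => ((η x : ℝ) : ℂ) := ⟨Complex.ofRealCLM.contDiff.comp h1,
      h2.comp_left (g := fun r : ℝ => (r : ℂ)) Complex.ofReal_zero⟩
    have h0 : (0 : E3) ∉ tsupport fun x => ((η x : ℝ) : ℂ) := fun h => h3 (hs h) rfl
    have hi : ∀ u : L2, Integrable fun x => u x * ((η x : ℝ) : ℂ) := fun u =>
      (Lp.memLp u).integrable_mul hφ.memLp
    have e : ∀ x, η x • (g x - g' x) = g x * ((η x : ℝ) : ℂ) - g' x * ((η x : ℝ) : ℂ) := fun x => by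
      rw [Complex.real_smul]; ring
    simp only [e]
    rw [integral_sub (hi g) (hi g'), hg _ hφ.1 hφ.2 h0, hg' _ hφ.1 hφ.2 h0, sub_self]
  refine Lp.ext ?_
  filter_upwards [h, ae_ne_zero] with x hx hx0 using sub_eq_zero.1 (hx hx0)

end SphericalHardy

end

theorem mainTheorem10 :
    (∀ f : SphericalHardy.H2, ∃! g : SphericalHardy.L2,
      SphericalHardy.IsWeakAngular f.toL2 g) ∧
    (∀ (f : SphericalHardy.H2) (g : SphericalHardy.L2),
      SphericalHardy.IsWeakAngular f.toL2 g → ‖g‖ ≤ 22 * ‖f‖) ∧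
    ∃ T : SphericalHardy.H2 →L[ℂ] SphericalHardy.L2,
      SphericalHardy.ExtendsAngular T ∧
      (∀ T' : SphericalHardy.H2 →L[ℂ] SphericalHardy.L2,
        SphericalHardy.ExtendsAngular T' → T' = T) ∧
      (∀ f : SphericalHardy.H2, SphericalHardy.IsWeakAngular f.toL2 (T f)) ∧
      ‖T‖ ≤ 22 := by
  refine ⟨fun f => ⟨SphericalHardy.angularCLM f, SphericalHardy.isWeakAngular_angularCLM f,
    fun g hg => hg.unique (SphericalHardy.isWeakAngular_angularCLM f)⟩, fun f g hg => ?_,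
    SphericalHardy.angularCLM, SphericalHardy.extendsAngular_angularCLM,
    fun T' hT' => hT'.eq_angularCLM, SphericalHardy.isWeakAngular_angularCLM,
    SphericalHardy.norm_angularCLM_le⟩
  rw [hg.unique (SphericalHardy.isWeakAngular_angularCLM f)]
  exact SphericalHardy.angularCLM.le_of_opNorm_le SphericalHardy.norm_angularCLM_le f
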